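/- **Conventions.** The plane $\mathbb R^2$ is oriented and identified with $\mathbb C$. An *oriented line* is a proper topological embedding $\ell:\mathbb R\to\mathbb R^2$, considered up to increasing reparametrization; $L(\ell)$ and $R(\ell)$ denote the components of its complement on its left and on its right. A line *separates* two sets disjoint from it if they lie on different sides of it. An *oriented foliation* $\mathcal F$ of the plane is a partition of the plane into oriented lines (leaves) which is locally trivial, compatibly with the orientations; $\phi_z$ denotes the leaf through $z$. It is a *Brouwer foliation* for a homeomorphism $f$ of the plane if $\overline{f(R(\phi))}\subset R(\phi)$ for every leaf $\phi$. A path $\gamma:[a,b]\to\mathbb R^2$ is *$\mathcal F$-transverse* if it is continuous and, for every $t\in[a,b]$, $\gamma([a,t))\subset L(\phi_{\gamma(t)})$ and $\gamma((t,b])\subset R(\phi_{\gamma(t)})$. An $\mathcal F$-transverse path $\gamma:[a,b]\to\mathbb R^2$ is *admissible of order* $n\in\mathbb N$ (for $f$) if $f^n(\phi_{\gamma(a)})\cap\phi_{\gamma(b)}\neq\emptyset$. Given oriented lines $\phi,\phi_1,\phi_2$, the line $\phi_2$ is *above* $\phi_1$ *relatively to* $\phi$ if the three lines are pairwise disjoint,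 none of them separates the two others, and, whenever $\alpha_1,\alpha_2$ are disjoint paths which meet the three lines only at their endpoints and $\alpha_i$ joins a point of $\phi_i$ to $\phi(u_i)$ ($i=1,2$), one has $u_1<u_2$. Two $\mathcal F$-transverse paths $\gamma_i:[a_i,b_i]\to\mathbb R^2$ ($i=1,2$) *intersect $\mathcal F$-transversally* (and positively) at $\gamma_1(t_1)=\gamma_2(t_2)$ if this equality holds and there are $a_i\le a_i'<t_i<b_i'\le b_i$ such that, with $\phi=\phi_{\gamma_1(t_1)}=\phi_{\gamma_2(t_2)}$, the leaf $\phi_{\gamma_2(a_2')}$ is above $\phi_{\gamma_1(a_1')}$ relatively to $\phi$, and $\phi_{\gamma_1(b_1')}$ is above $\phi_{\gamma_2(b_2')}$ relatively to $\phi$. **Proposition.** Let $f$ be a homeomorphism of the plane and let $\mathcal F$ be a Brouwer foliation for $f$. Suppose that two $\mathcal F$-transverse paths $\gamma_i:[a_i,b_i]\to\mathbb R^2$ ($i=1,2$) intersect $\mathcal F$-transversally at $\gamma_1(t_1)=\gamma_2(t_2)$, and that $\gamma_i$ is admissible of order $n_i$ for $i=1,2$. Then the concatenated paths $\gamma_1|_{[a_1,t_1]}\gamma_2|_{[t_2,b_2]}$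 and $\gamma_2|_{[a_2,t_2]}\gamma_1|_{[t_1,b_1]}$ are both admissible of order $n_1+n_2$. Moreover, either both of them are admissible of order $\max(n_1,n_2)$, or at least one of them is admissible of order $\min(n_1,n_2)$. -/

import Mathlib

/-! The oriented plane is `ℂ` with its usual topology and orientation. -/

/-- An oriented topological line of the plane, given by a parametrization compatible with its
orientation: a proper topological embedding of `ℝ` (between these spaces, closed embeddings and
proper embeddings are the same maps). -/
def IsLine (ℓ : ℝ → ℂ) : Prop := Topology.IsClosedEmbedding ℓ

/-- `SideIndexOne ℓ z w`: off the line `ℓ`, the point `z` has index one more than `w`. As `ℓ` is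
proper, `t ↦ (ℓ t - z) / (ℓ t - w)` tends to `1` at both ends of `ℝ`, so it is a closed curve in
`ℂ \ {0}`; the condition says that it winds exactly once, counterclockwise, around `0` (`θ` is a
continuous logarithm of it). For the upward vertical axis, `z = -1` and `w = 1` satisfy it. -/
def SideIndexOne (ℓ : ℝ → ℂ) (z w : ℂ) : Prop :=
  z ∉ Set.range ℓ ∧ w ∉ Set.range ℓ ∧
    ∃ θ : ℝ → ℂ, Continuous θ ∧ (∀ t, ℓ t - z = Complex.exp (θ t) * (ℓ t - w)) ∧
      Filter.Tendsto θ Filter.atBot (nhds 0) ∧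
      Filter.Tendsto θ Filter.atTop (nhds (2 * Real.pi * Complex.I))

/-- The left `L(ℓ)` of the oriented line `ℓ`: among the two components of the complement of `ℓ`,
the one on which the index of `ℓ` is larger by one. -/
def leftSide (ℓ : ℝ → ℂ) : Set ℂ := {z | ∃ w, SideIndexOne ℓ z w}

/-- The right `R(ℓ)` of the oriented line `ℓ`: the other component. -/
def rightSide (ℓ : ℝ → ℂ) : Set ℂ := {w | ∃ z, SideIndexOne ℓ z w}

/-- `ℓ` is a Brouwer line for the homeomorphism `f`. -/
def IsBrouwerLine (f : ℂ ≃ₜ ℂ) (ℓ : ℝ → ℂ) : Prop :=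
  IsLine ℓ ∧ closure (f '' rightSide ℓ) ⊆ rightSide ℓ

/-- The line `ℓ` separates `m` from `m'`: these lie on different sides of `ℓ`. -/
def Separates (ℓ m m' : ℝ → ℂ) : Prop :=
  (Set.range m ⊆ leftSide ℓ ∧ Set.range m' ⊆ rightSide ℓ) ∨
    (Set.range m ⊆ rightSide ℓ ∧ Set.range m' ⊆ leftSide ℓ)

/-- The oriented line `φ₂` is above the oriented line `φ₁` relatively to the oriented line `φ`:
the three lines are pairwise disjoint, none of them separates the two others, and whenever two
disjoint paths `α₁`, `α₂`, which meet the three lines only at their ends, join a point of `φ₁` to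
`φ t₁` and a point of `φ₂` to `φ t₂` respectively, then `t₁ < t₂`. -/
def IsAboveRel (φ φ₁ φ₂ : ℝ → ℂ) : Prop :=
  (Disjoint (Set.range φ) (Set.range φ₁) ∧ Disjoint (Set.range φ) (Set.range φ₂) ∧
      Disjoint (Set.range φ₁) (Set.range φ₂)) ∧
    (¬ Separates φ φ₁ φ₂ ∧ ¬ Separates φ₁ φ φ₂ ∧ ¬ Separates φ₂ φ φ₁) ∧
    ∀ (z₁ z₂ : ℂ) (t₁ t₂ : ℝ) (α₁ : Path z₁ (φ t₁)) (α₂ : Path z₂ (φ t₂)),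
      z₁ ∈ Set.range φ₁ → z₂ ∈ Set.range φ₂ →
      Disjoint (Set.range α₁) (Set.range α₂) →
      (∀ s ∈ Set.Ioo (0 : unitInterval) 1,
        α₁ s ∉ Set.range φ ∪ Set.range φ₁ ∪ Set.range φ₂ ∧
        α₂ s ∉ Set.range φ ∪ Set.range φ₁ ∪ Set.range φ₂) →
      t₁ < t₂

/-- An oriented topological foliation of the plane by (properly embedded) lines: a partition of
the plane into oriented lines which is locally trivial, compatibly with the orientations. -/
structure OrientedFoliation where
  /-- a parametrization, compatible with the orientation, of the leaf through a given point -/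
  leaf : ℂ → ℝ → ℂ
  isLine_leaf : ∀ z, IsLine (leaf z)
  mem_leaf : ∀ z, z ∈ Set.range (leaf z)
  leaf_eq : ∀ z w, w ∈ Set.range (leaf z) → leaf w = leaf z
  /-- Around each point there is a chart onto `ℝ × ℝ` whose upward vertical lines are positively
  oriented arcs of leaves. -/
  exists_chart : ∀ z, ∃ e : OpenPartialHomeomorph ℂ (ℝ × ℝ),
    z ∈ e.source ∧ e.target = Set.univ ∧
      ∀ u ∈ e.source, ∀ v ∈ e.source, (e u).1 = (e v).1 → (e u).2 < (e v).2 →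
        ∃ s t : ℝ, s < t ∧ leaf u s = u ∧ leaf u t = v

namespace OrientedFoliation

/-- A Brouwer foliation for `f`: every leaf is a Brouwer line for `f`. -/
def IsBrouwerFoliation (F : OrientedFoliation) (f : ℂ ≃ₜ ℂ) : Prop :=
  ∀ z, IsBrouwerLine f (F.leaf z)

/-- The path `γ : [a, b] → ℂ` is (positively) transverse to `F`. Paths on `[a, b]` are given by
functions on `ℝ`, of which only the values on `[a, b]` matter. -/
def IsTransverse (F : OrientedFoliation) (γ : ℝ → ℂ) (a b : ℝ) : Prop :=
  a ≤ b ∧ ContinuousOn γ (Set.Icc a b) ∧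
    ∀ t ∈ Set.Icc a b,
      (∀ u ∈ Set.Ico a t, γ u ∈ leftSide (F.leaf (γ t))) ∧
      (∀ u ∈ Set.Ioc t b, γ u ∈ rightSide (F.leaf (γ t)))

/-- The path `γ : [a, b] → ℂ` is transverse to `F` and admissible of order `n` for `f`. -/
def IsAdmissible (F : OrientedFoliation) (f : ℂ ≃ₜ ℂ) (γ : ℝ → ℂ) (a b : ℝ) (n : ℕ) : Prop :=
  F.IsTransverse γ a b ∧
    ((f^[n] '' Set.range (F.leaf (γ a))) ∩ Set.range (F.leaf (γ b))).Nonempty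

/-- The paths `γ₁ : [a₁, b₁] → ℂ` and `γ₂ : [a₂, b₂] → ℂ` are transverse to `F` and intersect
`F`-transversally (and positively) at the parameters `t₁`, `t₂`. -/
def IntersectTransversallyAt (F : OrientedFoliation) (γ₁ : ℝ → ℂ) (a₁ b₁ : ℝ)
    (γ₂ : ℝ → ℂ) (a₂ b₂ : ℝ) (t₁ t₂ : ℝ) : Prop :=
  F.IsTransverse γ₁ a₁ b₁ ∧ F.IsTransverse γ₂ a₂ b₂ ∧
    F.leaf (γ₁ t₁) = F.leaf (γ₂ t₂) ∧
    ∃ a₁' ∈ Set.Ico a₁ t₁, ∃ b₁' ∈ Set.Ioc t₁ b₁, ∃ a₂' ∈ Set.Ico a₂ t₂, ∃ b₂' ∈ Set.Ioc t₂ b₂,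
      IsAboveRel (F.leaf (γ₁ t₁)) (F.leaf (γ₁ a₁')) (F.leaf (γ₂ a₂')) ∧
      IsAboveRel (F.leaf (γ₁ t₁)) (F.leaf (γ₂ b₂')) (F.leaf (γ₁ b₁'))

end OrientedFoliation

/-- Concatenation of `γ` up to the parameter `t` with `γ'` from the parameter `t'` on: if `γ` is
considered on `[a, t]` and `γ'` on `[t', b']`, it is a path on `[a, t + (b' - t')]`. -/
noncomputable def concatAt (γ : ℝ → ℂ) (t : ℝ) (γ' : ℝ → ℂ) (t' : ℝ) : ℝ → ℂ :=
  fun s => if s ≤ t then γ s else γ' (t' + (s - t))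

/-! ### Continuous logarithms of ratios -/

open Set Filter Topology

/-! Let A₁, A₂ be the closed left half planes of the leaves through the starts of the two paths, and
B₁, B₂ the closed right half planes of the leaves through their ends. The Brouwer property gives Aᵢ
⊆ f(Aᵢ) and f(Bᵢ) ⊆ Bᵢ, and admissibility makes f^nᵢ(Aᵢ) meet Bᵢ. Let k + k' = n₁ + n₂, and suppose
that f^k(A₁) misses B₂ and f^k'(A₂) misses B₁. Split n₁ = p + q and n₂ = r + s with r + q = k and p
+ s = k'. Then f^q(A₁) ∪ f^(-p)(B₁) and f^s(A₂) ∪ f^(-r)(B₂) are connected and disjoint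
(`image_iterate_inter_or`), although the first joins A₁ to B₁ and the second A₂ to B₂; the
transversal intersection forbids this (`not_disjoint_of_isAboveRel`). So one of the two meetings
takes place, and it forces the boundary leaves themselves to be linked
(`FlatSides.image_inter_nonempty`).

Hence, whenever k + k' = n₁ + n₂, the first concatenation is admissible of order k or the second one
of order k'. Order 0 is impossible, since the end leaves of a concatenation are disjoint; so the
pairs (n₁ + n₂, 0) and (0, n₁ + n₂) give the first claim. The pairs (min, max) and (max, min) give
the second.

The crossing theorem is a computation with continuous logarithms of (z - p)/(z - q), where p and q
lie at the two ends of the first connected set. Along the central leaf such a logarithm grows by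
2πi. Disjointness of the two connected sets, together with disjoint paths to the central leaf
(`exists_disjoint_paths`, `exists_path_rayLog`), would make this growth vanish. The sides of a leaf
are defined by an index; foliation charts show that they are two connected open sets with the leaf
as common boundary (`FlatSides`). -/

/-- `θ` is a continuous logarithm of `(g - p) / (g - q)`. -/
def LogRatio {X : Type*} [TopologicalSpace X] (g : X → ℂ) (p q : ℂ) (θ : X → ℂ) : Prop :=
  Continuous θ ∧ ∀ t, g t - p = Complex.exp (θ t) * (g t - q)

namespace LogRatio

variable {X : Type*} [TopologicalSpace X] {g : X → ℂ} {p q r : ℂ} {θ θ' : X → ℂ}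

theorem refl (g : X → ℂ) (p : ℂ) : LogRatio g p p 0 :=
  ⟨continuous_const, fun t => by simp⟩

theorem symm (h : LogRatio g p q θ) : LogRatio g q p (-θ) := by
  refine ⟨h.1.neg, fun t => ?_⟩
  rw [h.2 t, Pi.neg_apply, ← mul_assoc, ← Complex.exp_add]
  simp

theorem trans (h : LogRatio g p q θ) (h' : LogRatio g q r θ') : LogRatio g p r (θ + θ') := by
  refine ⟨h.1.add h'.1, fun t => ?_⟩
  rw [h.2 t, h'.2 t, Pi.add_apply, Complex.exp_add, mul_assoc]

theorem add_int (h : LogRatio g p q θ) (n : ℤ) :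
    LogRatio g p q (fun t => θ t + n * (2 * Real.pi * Complex.I)) := by
  refine ⟨h.1.add continuous_const, fun t => ?_⟩
  rw [Complex.exp_add, Complex.exp_int_mul_two_pi_mul_I, mul_one]
  exact h.2 t

theorem exp_eq (h : LogRatio g p q θ) {t : X} (ht : g t ≠ q) :
    Complex.exp (θ t) = (g t - p) / (g t - q) := by
  rw [h.2 t, mul_div_cancel_right₀ _ (sub_ne_zero.2 ht)]

/-- The exponential is a covering of the punctured plane, so two lifts of one map on a connected
space agree everywhere once a period has been added to make them agree at `t₀`. -/
theorem eq_add_int [PreconnectedSpace X] (h : LogRatio g p q θ) (h' : LogRatio g p q θ')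
    (hq : q ∉ range g) (t₀ : X) :
    ∃ n : ℤ, (∀ t, θ t = θ' t + n * (2 * Real.pi * Complex.I)) := by
  have hne : ∀ t, g t ≠ q := fun t e => hq ⟨t, e⟩
  obtain ⟨n, hn⟩ := Complex.exp_eq_exp_iff_exists_int.1
    ((h.exp_eq (hne t₀)).trans (h'.exp_eq (hne t₀)).symm)
  refine ⟨n, fun t => ?_⟩
  have h'' := h'.add_int n
  refine congrFun (Complex.isCoveringMap_exp.eq_of_comp_eq h.1 h''.1 ?_ t₀ hn) t
  funext s
  exact Subtype.ext ((h.exp_eq (hne s)).trans (h''.exp_eq (hne s)).symm)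

theorem exists_of_simplyConnected [SimplyConnectedSpace X] [LocallyPathConnectedSpace X]
    (hg : Continuous g) (hp : p ∉ range g) (hq : q ∉ range g) : ∃ θ, LogRatio g p q θ := by
  have hne : ∀ t, g t - p ≠ 0 := fun t e => hp ⟨t, sub_eq_zero.1 e⟩
  have hne' : ∀ t, g t - q ≠ 0 := fun t e => hq ⟨t, sub_eq_zero.1 e⟩
  obtain ⟨t₀⟩ : Nonempty X := inferInstance
  obtain ⟨F, ⟨-, hF⟩, -⟩ := Complex.isCoveringMapOn_exp.existsUnique_continuousMap_lifts
    (⟨fun t => (g t - p) / (g t - q),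
      (hg.sub continuous_const).div (hg.sub continuous_const) hne'⟩ : C(X, ℂ))
    (a₀ := t₀) (Complex.exp_log (div_ne_zero (hne t₀) (hne' t₀)))
    (fun t => div_ne_zero (hne t) (hne' t))
  refine ⟨F, F.continuous, fun t => ?_⟩
  have : Complex.exp (F t) = (g t - p) / (g t - q) := congrFun hF t
  rw [this, div_mul_cancel₀ _ (hne' t)]

theorem one_sub_mem_slitPlane {u : ℂ} (hu : ‖u‖ < 1) : 1 - u ∈ Complex.slitPlane := by
  apply Complex.mem_slitPlane_of_norm_lt_one (z := -u)
  simpa using hu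

/-- The principal logarithm works for points close to each other. -/
theorem of_near (hg : Continuous g) (h : ∀ t, ‖p - q‖ < ‖g t - q‖) :
    LogRatio g p q (fun t => Complex.log (1 - (p - q) / (g t - q))) := by
  have hpos : ∀ t, 0 < ‖g t - q‖ := fun t => (norm_nonneg _).trans_lt (h t)
  have hs : ∀ t, 1 - (p - q) / (g t - q) ∈ Complex.slitPlane := fun t =>
    one_sub_mem_slitPlane (by rw [norm_div, div_lt_one (hpos t)]; exact h t)
  have hne : ∀ t, g t - q ≠ 0 := fun t => norm_pos_iff.1 (hpos t)
  refine ⟨?_, fun t => ?_⟩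
  · refine Continuous.clog ?_ hs
    exact continuous_const.sub (continuous_const.div (hg.sub continuous_const) hne)
  · rw [Complex.exp_log (Complex.slitPlane_ne_zero (hs t)), sub_mul, div_mul_cancel₀ _ (hne t)]
    ring

end LogRatio

/-- A point off a closed set has positive distance to it. This supplies the hypothesis of
`LogRatio.of_near` for all nearby points, uniformly in the parameter. -/
theorem eventually_near_of_isClosed_range {X : Type*} {g : X → ℂ} (hg : IsClosed (range g)) {z : ℂ}
    (hz : z ∉ range g) : ∀ᶠ w in 𝓝 z, ∀ t, ‖w - z‖ < ‖g t - z‖ := by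
  obtain ⟨ε, hε, h⟩ := Metric.isOpen_iff.1 hg.isOpen_compl z hz
  filter_upwards [Metric.ball_mem_nhds z hε] with w hw t
  rw [mem_ball_iff_norm] at hw
  refine hw.trans_le ?_
  by_contra! hlt
  exact h (mem_ball_iff_norm.2 hlt) ⟨t, rfl⟩

/-- The ratio tends to 1 as `g` escapes to infinity, so the principal logarithm is the branch
normalized at infinity. -/
theorem tendsto_log_near {X : Type*} {l : Filter X} {g : X → ℂ} (hg : Tendsto g l (cocompact ℂ))
    (p q : ℂ) : Tendsto (fun t => Complex.log (1 - (p - q) / (g t - q))) l (𝓝 0) := by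
  have h1 : Tendsto (fun t => g t - q) l (cocompact ℂ) := by
    have := (Homeomorph.addRight (-q)).isClosedEmbedding.tendsto_cocompact
    simpa [Function.comp_def, sub_eq_add_neg] using this.comp hg
  have h2 : Tendsto (fun t => (p - q) / (g t - q)) l (𝓝 0) := by
    have h3 : Tendsto (fun t => (g t - q)⁻¹) l (𝓝 0) := (tendsto_inv₀_cobounded (α := ℂ)).comp
      (by rwa [Metric.cobounded_eq_cocompact])
    simpa [div_eq_mul_inv] using h3.const_mul (p - q)
  have h3 : Tendsto (fun t => 1 - (p - q) / (g t - q)) l (𝓝 1) := by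
    simpa using tendsto_const_nhds.sub h2
  simpa using h3.clog (by simp)


/-! ### Logarithms along paths -/

/-- `δ` is the drop, from the start to the end of the path `g`, of a logarithm of
`(g - p) / (g - q)`. -/
def PathLog {x y : ℂ} (g : Path x y) (p q δ : ℂ) : Prop :=
  ∃ θ : unitInterval → ℂ, LogRatio g p q θ ∧ θ 0 - θ 1 = δ

namespace PathLog

variable {x y z p q r δ δ' : ℂ} {g g' : Path x y}

theorem exists_of_notMem (g : Path x y) (hp : p ∉ range g) (hq : q ∉ range g) :
    ∃ δ, PathLog g p q δ := by
  obtain ⟨θ, hθ⟩ := LogRatio.exists_of_simplyConnected (g := g.extend)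
    (p := p) (q := q) g.continuous_extend
    (by rwa [Path.extend_range]) (by rwa [Path.extend_range])
  refine ⟨_, fun t => θ t, ⟨hθ.1.comp continuous_subtype_val, fun t => ?_⟩, rfl⟩
  simpa using hθ.2 t

theorem unique (hq : q ∉ range g) (h : PathLog g p q δ) (h' : PathLog g p q δ') : δ = δ' := by
  obtain ⟨θ, hθ, rfl⟩ := h
  obtain ⟨θ', hθ', rfl⟩ := h'
  obtain ⟨n, hn⟩ := hθ.eq_add_int hθ' hq 0
  rw [hn 0, hn 1]
  ring

theorem reverse (h : PathLog g p q δ) : PathLog g.symm p q (-δ) := by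
  obtain ⟨θ, hθ, rfl⟩ := h
  exact ⟨fun t => θ (unitInterval.symm t), ⟨hθ.1.comp unitInterval.continuous_symm,
    fun t => hθ.2 _⟩, by simp⟩

theorem trans {g₁ : Path x y} {g₂ : Path y z} (hq : y ≠ q) (h : PathLog g₁ p q δ)
    (h' : PathLog g₂ p q δ') : PathLog (g₁.trans g₂) p q (δ + δ') := by
  obtain ⟨θ, hθ, rfl⟩ := h
  obtain ⟨θ', hθ', rfl⟩ := h'
  -- At the common point the two logarithms differ by a period; shifting the second one glues them
  -- and leaves its drop unchanged.
  have he : Complex.exp (θ 1) = Complex.exp (θ' 0) := by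
    rw [hθ.exp_eq (by simpa using hq), hθ'.exp_eq (by simpa using hq), g₁.target, g₂.source]
  let Θ : Path (θ 0) (θ 1) := ⟨⟨θ, hθ.1⟩, rfl, rfl⟩
  let Θ' : Path (θ 1) (θ' 1 + (θ 1 - θ' 0)) :=
    ⟨⟨fun t => θ' t + (θ 1 - θ' 0), hθ'.1.add continuous_const⟩, by simp, rfl⟩
  refine ⟨Θ.trans Θ', ⟨(Θ.trans Θ').continuous, fun t => ?_⟩, ?_⟩
  · rw [Path.trans_apply, Path.trans_apply]
    split_ifs with ht
    · exact hθ.2 _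
    · change _ = Complex.exp (θ' _ + (θ 1 - θ' 0)) * _
      rw [Complex.exp_add, Complex.exp_sub, he, div_self (Complex.exp_ne_zero _), mul_one]
      exact hθ'.2 _
  · rw [Path.source, Path.target]
    ring

theorem trans_points (h : PathLog g p q δ) (h' : PathLog g q r δ') : PathLog g p r (δ + δ') := by
  obtain ⟨θ, hθ, rfl⟩ := h
  obtain ⟨θ', hθ', rfl⟩ := h'
  exact ⟨_, hθ.trans hθ', by simp only [Pi.add_apply]; ring⟩

theorem symm_points (h : PathLog g p q δ) : PathLog g q p (-δ) := by
  obtain ⟨θ, hθ, rfl⟩ := h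
  exact ⟨_, hθ.symm, by simp only [Pi.neg_apply]; ring⟩

end PathLog

/-- Two paths with the same ends wind in the same way around two points that lie in a
connected set avoiding both paths. -/
theorem exists_pathLog_of_isPreconnected {x y : ℂ} (g g' : Path x y) {K : Set ℂ}
    (hK : IsPreconnected K) (hg : Disjoint (range g) K) (hg' : Disjoint (range g') K) {p q : ℂ}
    (hp : p ∈ K) (hq : q ∈ K) : ∃ δ, PathLog g p q δ ∧ PathLog g' p q δ := by
  refine hK.induction₂ (fun p q => ∃ δ, PathLog g p q δ ∧ PathLog g' p q δ) ?_ ?_ ?_ hp hq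
  -- For nearby points the principal logarithm serves along both paths, and its drop depends only on
  -- their common ends. The relation is transitive and symmetric, hence spreads over `K`.
  · intro z hz
    have h1 := eventually_near_of_isClosed_range (isCompact_range g.continuous).isClosed
      (disjoint_right.1 hg hz)
    have h2 := eventually_near_of_isClosed_range (isCompact_range g'.continuous).isClosed
      (disjoint_right.1 hg' hz)
    filter_upwards [nhdsWithin_le_nhds h1, nhdsWithin_le_nhds h2] with w hw hw'
    exact ⟨_, PathLog.symm_points ⟨_, .of_near g.continuous hw, rfl⟩,
      PathLog.symm_points ⟨_, .of_near g'.continuous hw', by simp⟩⟩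
  · rintro a b c - - - ⟨δ, h, h'⟩ ⟨η, k, k'⟩
    exact ⟨_, h.trans_points k, h'.trans_points k'⟩
  · rintro a b - - ⟨δ, h, h'⟩
    exact ⟨_, h.symm_points, h'.symm_points⟩

/-- Seen from a point `p` farther out than both paths, `1 - k t / p` stays in the slit plane, so its
principal logarithm has a drop that depends only on the ends of `k`. -/
theorem exists_pathLog_far {x y : ℂ} (g g' : Path x y) :
    ∃ C : ℝ, ∀ p q : ℂ, C < ‖p‖ → C < ‖q‖ → ∃ δ, PathLog g p q δ ∧ PathLog g' p q δ := by
  have hcpt := (isCompact_range g.continuous).union (isCompact_range g'.continuous)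
  obtain ⟨C, hC⟩ := hcpt.isBounded.exists_norm_le
  have key : ∀ p : ℂ, max C 0 < ‖p‖ → ∀ k : Path x y, (∀ t, ‖k t‖ ≤ C) →
      ∃ θ : unitInterval → ℂ, Continuous θ ∧ (∀ t, k t - p = -p * Complex.exp (θ t)) ∧
        θ 0 - θ 1 = Complex.log (1 - x / p) - Complex.log (1 - y / p) := by
    intro p hp k hk
    have hp0 : 0 < ‖p‖ := (le_max_right _ _).trans_lt hp
    have hpne : p ≠ 0 := norm_pos_iff.1 hp0
    have hs : ∀ t, 1 - k t / p ∈ Complex.slitPlane := fun t =>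
      LogRatio.one_sub_mem_slitPlane (by
        rw [norm_div, div_lt_one hp0]
        exact (hk t).trans_lt ((le_max_left _ _).trans_lt hp))
    refine ⟨fun t => Complex.log (1 - k t / p), Continuous.clog (by fun_prop) hs, fun t => ?_, by simp⟩
    rw [Complex.exp_log (Complex.slitPlane_ne_zero (hs t))]
    field_simp
    ring
  have key' : ∀ p q : ℂ, max C 0 < ‖p‖ → max C 0 < ‖q‖ → ∀ k : Path x y, (∀ t, ‖k t‖ ≤ C) →
      PathLog k p q ((Complex.log (1 - x / p) - Complex.log (1 - y / p)) -
        (Complex.log (1 - x / q) - Complex.log (1 - y / q))) := by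
    intro p q hp hq k hk
    obtain ⟨θ, hθ, e, hδ⟩ := key p hp k hk
    obtain ⟨θ', hθ', e', hδ'⟩ := key q hq k hk
    have hpne : p ≠ 0 := norm_pos_iff.1 ((le_max_right _ _).trans_lt hp)
    have hqne : q ≠ 0 := norm_pos_iff.1 ((le_max_right _ _).trans_lt hq)
    refine ⟨fun t => θ t - θ' t + Complex.log (p / q), ⟨by fun_prop, fun t => ?_⟩, ?_⟩
    · rw [e t, e' t, Complex.exp_add, Complex.exp_log (div_ne_zero hpne hqne), Complex.exp_sub]
      have := Complex.exp_ne_zero (θ' t)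
      field_simp
    · rw [← hδ, ← hδ']
      ring
  refine ⟨max C 0, fun p q hp hq => ⟨_, key' p q hp hq g fun t => hC _ (Or.inl ⟨t, rfl⟩),
    key' p q hp hq g' fun t => hC _ (Or.inr ⟨t, rfl⟩)⟩⟩

/-- Two paths with the same ends wind in the same way around `p` and `q` if each of these points
can be connected to infinity off both paths. -/
theorem PathLog.eq_of_unbounded {x y : ℂ} {g g' : Path x y} {A B : Set ℂ} {p q δ δ' : ℂ}
    (hA : IsPreconnected A) (hB : IsPreconnected B) (hA' : ¬ Bornology.IsBounded A)
    (hB' : ¬ Bornology.IsBounded B) (hp : p ∈ A) (hq : q ∈ B) (hgA : Disjoint (range g) A)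
    (hgB : Disjoint (range g) B) (hgA' : Disjoint (range g') A) (hgB' : Disjoint (range g') B)
    (h : PathLog g p q δ) (h' : PathLog g' p q δ') : δ = δ' := by
  obtain ⟨C, hC⟩ := exists_pathLog_far g g'
  have far : ∀ S : Set ℂ, ¬ Bornology.IsBounded S → ∃ p ∈ S, C < ‖p‖ := by
    intro S hS
    by_contra! hcon
    exact hS (isBounded_iff_forall_norm_le.2 ⟨C, hcon⟩)
  -- The pair `p`, `q` is compared through far points `p'` of `A` and `q'` of `B`; on each of the
  -- three pieces the two paths have the same drop.
  obtain ⟨p', hp', hCp⟩ := far A hA'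
  obtain ⟨q', hq', hCq⟩ := far B hB'
  obtain ⟨a, ha, ha'⟩ := exists_pathLog_of_isPreconnected g g' hA hgA hgA' hp hp'
  obtain ⟨b, hb, hb'⟩ := hC p' q' hCp hCq
  obtain ⟨c, hc, hc'⟩ := exists_pathLog_of_isPreconnected g g' hB hgB hgB' hq' hq
  rw [h.unique (disjoint_right.1 hgB hq) ((ha.trans_points hb).trans_points hc),
    h'.unique (disjoint_right.1 hgB' hq) ((ha'.trans_points hb').trans_points hc')]

/-! ### Logarithms along rays -/

/-- `ζ` is the initial value of the logarithm of `(g - p) / (g - q)` that tends to `0` at the end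
of the ray `g`. -/
def RayLog (g : ℝ → ℂ) (p q ζ : ℂ) : Prop :=
  ∃ θ : ℝ → ℂ, LogRatio g p q θ ∧ Tendsto θ atTop (𝓝 0) ∧ θ 0 = ζ

/-- `g`, restricted to nonnegative parameters, is a proper ray in `S` that starts at `x`. -/
structure IsRayIn (g : ℝ → ℂ) (S : Set ℂ) (x : ℂ) : Prop where
  continuous : Continuous g
  isClosed_range : IsClosed (range g)
  range_subset : range g ⊆ S
  tendsto : Tendsto g atTop (cocompact ℂ)
  apply_of_nonpos : ∀ t ≤ 0, g t = x

theorem IsRayIn.apply_zero {g : ℝ → ℂ} {S : Set ℂ} {x : ℂ} (h : IsRayIn g S x) : g 0 = x :=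
  h.apply_of_nonpos 0 le_rfl

theorem RayLog.unique {g : ℝ → ℂ} {p q ζ ζ' : ℂ} (hq : q ∉ range g) (h : RayLog g p q ζ)
    (h' : RayLog g p q ζ') : ζ = ζ' := by
  obtain ⟨θ, hθ, ht, rfl⟩ := h
  obtain ⟨θ', hθ', ht', rfl⟩ := h'
  obtain ⟨n, hn⟩ := hθ.eq_add_int hθ' hq 0
  have h1 : Tendsto θ atTop (𝓝 (0 + n * (2 * Real.pi * Complex.I))) :=
    (ht'.add tendsto_const_nhds).congr fun t => (hn t).symm
  have h2 := tendsto_nhds_unique ht h1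
  rw [hn 0, ← zero_add (_ * _), ← h2, add_zero]

theorem RayLog.trans_points {g : ℝ → ℂ} {p q r ζ ζ' : ℂ} (h : RayLog g p q ζ)
    (h' : RayLog g q r ζ') : RayLog g p r (ζ + ζ') := by
  obtain ⟨θ, hθ, ht, rfl⟩ := h
  obtain ⟨θ', hθ', ht', rfl⟩ := h'
  exact ⟨_, hθ.trans hθ', by simpa [Pi.add_def] using ht.add ht', rfl⟩

theorem RayLog.symm_points {g : ℝ → ℂ} {p q ζ : ℂ} (h : RayLog g p q ζ) :
    RayLog g q p (-ζ) := by
  obtain ⟨θ, hθ, ht, rfl⟩ := h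
  exact ⟨_, hθ.symm, by simpa [Pi.neg_def] using ht.neg, rfl⟩

/-- For nearby points the principal logarithm vanishes at infinity along both rays and has the same
value at their common origin; connectedness of `K` propagates this. -/
theorem IsRayIn.exists_rayLog_of_isPreconnected {g g' : ℝ → ℂ} {S S' K : Set ℂ} {x p q : ℂ}
    (hg : IsRayIn g S x) (hg' : IsRayIn g' S' x) (hK : IsPreconnected K) (hS : Disjoint S K)
    (hS' : Disjoint S' K) (hp : p ∈ K) (hq : q ∈ K) :
    ∃ ζ, RayLog g p q ζ ∧ RayLog g' p q ζ := by
  refine hK.induction₂ (fun p q => ∃ ζ, RayLog g p q ζ ∧ RayLog g' p q ζ) ?_ ?_ ?_ hp hq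
  · intro z hz
    have h1 := eventually_near_of_isClosed_range hg.isClosed_range
      (disjoint_right.1 (hS.mono_left hg.range_subset) hz)
    have h2 := eventually_near_of_isClosed_range hg'.isClosed_range
      (disjoint_right.1 (hS'.mono_left hg'.range_subset) hz)
    filter_upwards [nhdsWithin_le_nhds h1, nhdsWithin_le_nhds h2] with w hw hw'
    exact ⟨_, RayLog.symm_points ⟨_, .of_near hg.continuous hw, tendsto_log_near hg.tendsto _ _, rfl⟩,
      RayLog.symm_points ⟨_, .of_near hg'.continuous hw', tendsto_log_near hg'.tendsto _ _,
        by simp [hg.apply_zero, hg'.apply_zero]⟩⟩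
  · rintro a b c - - - ⟨δ, h, h'⟩ ⟨η, k, k'⟩
    exact ⟨_, h.trans_points k, h'.trans_points k'⟩
  · rintro a b - - ⟨δ, h, h'⟩
    exact ⟨_, h.symm_points, h'.symm_points⟩

/-- Two rays that start at the same point have the same logarithm there, if the two points can be
connected off both rays. -/
theorem RayLog.eq_of_isPreconnected {g g' : ℝ → ℂ} {S S' K : Set ℂ} {x p q ζ ζ' : ℂ}
    (hg : IsRayIn g S x) (hg' : IsRayIn g' S' x) (hK : IsPreconnected K) (hS : Disjoint S K)
    (hS' : Disjoint S' K) (hp : p ∈ K) (hq : q ∈ K) (h : RayLog g p q ζ)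
    (h' : RayLog g' p q ζ') : ζ = ζ' := by
  obtain ⟨η, k, k'⟩ := hg.exists_rayLog_of_isPreconnected hg' hK hS hS' hp hq
  rw [h.unique (disjoint_right.1 (hS.mono_left hg.range_subset) hq) k,
    h'.unique (disjoint_right.1 (hS'.mono_left hg'.range_subset) hq) k']

/-- Every continuous logarithm along a proper ray tends to a multiple of `2πi`. -/
theorem LogRatio.exists_tendsto_atTop {g : ℝ → ℂ} {p q : ℂ} {θ : ℝ → ℂ} (h : LogRatio g p q θ)
    (hg : Continuous g) (hq : q ∉ range g) (ht : Tendsto g atTop (cocompact ℂ)) :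
    ∃ n : ℤ, Tendsto θ atTop (𝓝 (n * (2 * Real.pi * Complex.I))) := by
  have h1 : ∀ᶠ t in atTop, ‖p - q‖ < ‖g t - q‖ := by
    have h2 : Tendsto (fun t => g t - q) atTop (cocompact ℂ) := by
      have := (Homeomorph.addRight (-q)).isClosedEmbedding.tendsto_cocompact
      simpa [Function.comp_def, sub_eq_add_neg] using this.comp ht
    exact (tendsto_norm_cocompact_atTop.comp h2).eventually_gt_atTop _
  obtain ⟨T, hT⟩ := eventually_atTop.1 h1
  -- Freezing the ray before `T` makes the principal logarithm available on all of `ℝ`, where it can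
  -- be compared with `θ`.
  have hc : Continuous fun t : ℝ => max t T := by fun_prop
  have k : LogRatio (fun t => g (max t T)) p q (fun t => θ (max t T)) :=
    ⟨h.1.comp hc, fun t => h.2 _⟩
  have k' := LogRatio.of_near (g := fun t => g (max t T)) (hg.comp hc)
    (p := p) (q := q) fun t => hT _ (le_max_right _ _)
  obtain ⟨n, hn⟩ := k.eq_add_int k' (by rintro ⟨t, e⟩; exact hq ⟨_, e⟩) 0
  refine ⟨n, ?_⟩
  have h3 := (tendsto_log_near ht p q).add_const (n * (2 * Real.pi * Complex.I))
  rw [zero_add] at h3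
  refine h3.congr' ?_
  filter_upwards [eventually_ge_atTop T] with t ht'
  have := hn t
  simp only [max_eq_left ht'] at this
  exact this.symm

theorem LogRatio.exists_tendsto_atBot {g : ℝ → ℂ} {p q : ℂ} {θ : ℝ → ℂ} (h : LogRatio g p q θ)
    (hg : Continuous g) (hq : q ∉ range g) (ht : Tendsto g atBot (cocompact ℂ)) :
    ∃ n : ℤ, Tendsto θ atBot (𝓝 (n * (2 * Real.pi * Complex.I))) := by
  obtain ⟨n, hn⟩ := LogRatio.exists_tendsto_atTop (g := fun t => g (-t)) (θ := fun t => θ (-t))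
    ⟨h.1.comp continuous_neg, fun t => h.2 _⟩ (hg.comp continuous_neg)
    (by rintro ⟨t, e⟩; exact hq ⟨_, e⟩) (ht.comp tendsto_neg_atTop_atBot)
  refine ⟨n, ?_⟩
  simpa [Function.comp_def] using hn.comp tendsto_neg_atBot_atTop

theorem IsRayIn.exists_rayLog {g : ℝ → ℂ} {S : Set ℂ} {x p q : ℂ} (hg : IsRayIn g S x)
    (hp : p ∉ S) (hq : q ∉ S) : ∃ ζ, RayLog g p q ζ := by
  have hq' : q ∉ range g := fun h => hq (hg.range_subset h)
  obtain ⟨θ, hθ⟩ := LogRatio.exists_of_simplyConnected hg.continuous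
    (fun h => hp (hg.range_subset h)) hq'
  obtain ⟨n, hn⟩ := hθ.exists_tendsto_atTop hg.continuous hq' hg.tendsto
  refine ⟨_, _, hθ.add_int (-n), ?_, rfl⟩
  have := hn.add_const (((-n : ℤ) : ℂ) * (2 * Real.pi * Complex.I))
  simpa using this

/-- A ray preceded by a path. -/
theorem IsRayIn.prepend {g : ℝ → ℂ} {S : Set ℂ} {x y : ℂ} (hg : IsRayIn g S x) (c : Path y x) :
    ∃ g' : ℝ → ℂ, IsRayIn g' (range c ∪ S) y ∧ ∀ p q δ ζ, x ≠ q → PathLog c p q δ →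
      RayLog g p q ζ → RayLog g' p q (δ + ζ) := by
  let g' : ℝ → ℂ := fun t => if t ≤ 1 then c.extend t else g (t - 1)
  have hr : range g' = range c ∪ range g := by
    apply subset_antisymm
    · rintro _ ⟨t, rfl⟩
      by_cases ht : t ≤ 1
      · simp only [g', if_pos ht]
        exact Or.inl (c.extend_range ▸ mem_range_self t)
      · simp only [g', if_neg ht]
        exact Or.inr ⟨_, rfl⟩
    · rintro _ (⟨t, rfl⟩ | ⟨t, rfl⟩)
      · exact ⟨t, by simp [g', t.2.2]⟩
      · by_cases ht : t ≤ 0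
        · exact ⟨1, by simp [g', hg.apply_of_nonpos t ht]⟩
        · exact ⟨t + 1, by simp [g', ht]⟩
  have hc : Continuous g' := by
    refine Continuous.if_le c.continuous_extend (hg.continuous.comp (by fun_prop))
      continuous_id continuous_const ?_
    rintro t rfl
    simp [hg.apply_zero]
  refine ⟨g', ⟨hc, ?_, ?_, ?_, ?_⟩, ?_⟩
  · rw [hr]
    exact (isCompact_range c.continuous).isClosed.union hg.isClosed_range
  · rw [hr]
    exact union_subset_union_right _ hg.range_subset
  · refine (hg.tendsto.comp (tendsto_atTop_add_const_right atTop (-1) tendsto_id)).congr' ?_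
    filter_upwards [eventually_gt_atTop 1] with t ht
    simp [g', not_le.2 ht, sub_eq_add_neg]
  · intro t ht
    simp [g', ht.trans zero_le_one, c.extend_of_le_zero ht]
  · rintro p q _ _ hx ⟨θ, hθ, rfl⟩ ⟨θ', hθ', hlim, rfl⟩
    -- The logarithm along the path is shifted by a period to meet the one along the ray, which is
    -- already normalized at infinity.
    have he : Complex.exp (θ 1) = Complex.exp (θ' 0) := by
      rw [hθ.exp_eq (by simpa using hx), hθ'.exp_eq (by simpa [hg.apply_zero] using hx), c.target,
        hg.apply_zero]
    refine ⟨fun t => if t ≤ 1 then θ (projIcc 0 1 zero_le_one t) + (θ' 0 - θ 1) else θ' (t - 1),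
      ⟨?_, fun t => ?_⟩, ?_, ?_⟩
    · refine Continuous.if_le ((hθ.1.comp continuous_projIcc).add continuous_const)
        (hθ'.1.comp (by fun_prop)) continuous_id continuous_const ?_
      rintro t rfl
      simp
    · by_cases ht : t ≤ 1
      · simp only [g', if_pos ht]
        rw [Complex.exp_add, Complex.exp_sub, he, div_self (Complex.exp_ne_zero _), mul_one]
        exact hθ.2 _
      · simp only [g', if_neg ht]
        exact hθ'.2 _
    · refine (hlim.comp (tendsto_atTop_add_const_right atTop (-1) tendsto_id)).congr' ?_
      filter_upwards [eventually_gt_atTop 1] with t ht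
      simp [not_le.2 ht, sub_eq_add_neg]
    · simp
      ring

/-- The half of a proper line from the parameter `s` on. -/
theorem Topology.IsClosedEmbedding.isRayIn {ℓ : ℝ → ℂ} (h : IsClosedEmbedding ℓ) (s : ℝ) :
    IsRayIn (fun t => ℓ (s + max t 0)) (ℓ '' Ici s) (ℓ s) := by
  have hr : range (fun t => ℓ (s + max t 0)) = ℓ '' Ici s := by
    ext z
    constructor
    · rintro ⟨t, rfl⟩
      exact ⟨_, by simp, rfl⟩
    · rintro ⟨t, ht, rfl⟩
      exact ⟨t - s, by simp [sub_nonneg.2 (mem_Ici.1 ht)]⟩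
  refine ⟨h.continuous.comp (by fun_prop), ?_, hr.subset, ?_, fun t ht => by simp [ht]⟩
  · rw [hr]
    exact h.isClosedMap _ isClosed_Ici
  · refine (h.tendsto_cocompact.mono_left atTop_le_cocompact).comp ?_
    exact tendsto_atTop_add_const_left _ _ (tendsto_atTop_mono (fun t => le_max_left t 0) tendsto_id)

/-- Subtracting the limit `c` normalizes the branch at infinity, and `exp c = 1` keeps it a
logarithm. For the central leaf, `c` is 2πi at the upper end and 0 at the lower one. -/
theorem LogRatio.rayLog {ℓ θ : ℝ → ℂ} {p q c : ℂ} (h : LogRatio ℓ p q θ)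
    (ht : Tendsto θ atTop (𝓝 c)) (hc : Complex.exp c = 1) (s : ℝ) :
    RayLog (fun t => ℓ (s + max t 0)) p q (θ s - c) := by
  refine ⟨fun t => θ (s + max t 0) - c, ⟨?_, fun t => ?_⟩, ?_, by simp⟩
  · exact (h.1.comp (by fun_prop)).sub continuous_const
  · rw [Complex.exp_sub, hc, div_one]
    exact h.2 _
  · have h1 : Tendsto (fun t : ℝ => s + max t 0) atTop atTop :=
      tendsto_atTop_add_const_left _ _ (tendsto_atTop_mono (fun t => le_max_left t 0) tendsto_id)
    simpa [Function.comp_def] using (ht.comp h1).sub_const c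

theorem Topology.IsClosedEmbedding.comp_neg {ℓ : ℝ → ℂ} (h : IsClosedEmbedding ℓ) :
    IsClosedEmbedding fun t => ℓ (-t) :=
  h.comp (Homeomorph.neg ℝ).isClosedEmbedding

theorem LogRatio.comp_neg {ℓ θ : ℝ → ℂ} {p q : ℂ} (h : LogRatio ℓ p q θ) :
    LogRatio (fun t => ℓ (-t)) p q (fun t => θ (-t)) :=
  ⟨h.1.comp continuous_neg, fun _ => h.2 _⟩

/-- The arc of a curve between two parameters, as a path, with the drop of a logarithm. -/
theorem exists_path_arc {ℓ : ℝ → ℂ} (h : Continuous ℓ) (u v : ℝ) :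
    ∃ c : Path (ℓ u) (ℓ v), range c ⊆ range ℓ ∧
      ∀ p q θ, LogRatio ℓ p q θ → PathLog c p q (θ u - θ v) := by
  let k : unitInterval → ℝ := fun t => u + t * (v - u)
  have hk : Continuous k := by fun_prop
  refine ⟨⟨⟨fun t => ℓ (k t), h.comp hk⟩, by simp [k], by simp [k]⟩, ?_, ?_⟩
  · rintro _ ⟨t, rfl⟩
    exact ⟨_, rfl⟩
  · intro p q θ hθ
    exact ⟨fun t => θ (k t), ⟨hθ.1.comp hk, fun t => hθ.2 _⟩, by simp [k]⟩

/-! ### The index of a line -/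

/-- The index of the line `ℓ` at `z` exceeds that at `w` by `n`. -/
def LineIndex (ℓ : ℝ → ℂ) (z w : ℂ) (n : ℤ) : Prop :=
  ∃ θ : ℝ → ℂ, LogRatio ℓ z w θ ∧ Tendsto θ atBot (𝓝 0) ∧
    Tendsto θ atTop (𝓝 (n * (2 * Real.pi * Complex.I)))

namespace LineIndex

variable {ℓ : ℝ → ℂ} {x y z w : ℂ} {m n : ℤ}

theorem exists_of_notMem (h : IsLine ℓ) (hz : z ∉ range ℓ) (hw : w ∉ range ℓ) :
    ∃ n, LineIndex ℓ z w n := by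
  obtain ⟨θ, hθ⟩ := LogRatio.exists_of_simplyConnected h.continuous hz hw
  obtain ⟨m, hm⟩ := hθ.exists_tendsto_atBot h.continuous hw
    (h.tendsto_cocompact.mono_left atBot_le_cocompact)
  obtain ⟨n, hn⟩ := hθ.exists_tendsto_atTop h.continuous hw
    (h.tendsto_cocompact.mono_left atTop_le_cocompact)
  refine ⟨n - m, _, hθ.add_int (-m), ?_, ?_⟩
  · simpa using hm.add_const (((-m : ℤ) : ℂ) * (2 * Real.pi * Complex.I))
  · convert hn.add_const (((-m : ℤ) : ℂ) * (2 * Real.pi * Complex.I)) using 2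
    push_cast
    ring

theorem unique (hw : w ∉ range ℓ) (h : LineIndex ℓ z w m) (h' : LineIndex ℓ z w n) : m = n := by
  obtain ⟨θ, hθ, h0, h1⟩ := h
  obtain ⟨θ', hθ', h0', h1'⟩ := h'
  obtain ⟨k, hk⟩ := hθ.eq_add_int hθ' hw 0
  obtain rfl : θ = fun t => θ' t + k * (2 * Real.pi * Complex.I) := funext hk
  have e0 := tendsto_nhds_unique h0 (h0'.add_const _)
  have e1 := tendsto_nhds_unique h1 (h1'.add_const _)
  rw [zero_add] at e0
  rw [← e0, add_zero] at e1
  exact_mod_cast mul_right_cancel₀ Complex.two_pi_I_ne_zero e1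

theorem trans (h : LineIndex ℓ x y m) (h' : LineIndex ℓ y z n) : LineIndex ℓ x z (m + n) := by
  obtain ⟨θ, hθ, h0, h1⟩ := h
  obtain ⟨θ', hθ', h0', h1'⟩ := h'
  refine ⟨_, hθ.trans hθ', by simpa [Pi.add_def] using h0.add h0', ?_⟩
  rw [Int.cast_add, add_mul]
  exact h1.add h1'

theorem symm (h : LineIndex ℓ x y m) : LineIndex ℓ y x (-m) := by
  obtain ⟨θ, hθ, h0, h1⟩ := h
  refine ⟨_, hθ.symm, by simpa [Pi.neg_def] using h0.neg, ?_⟩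
  rw [Int.cast_neg, neg_mul]
  exact h1.neg

theorem eventually_zero (h : IsLine ℓ) (hz : z ∉ range ℓ) :
    ∀ᶠ w in 𝓝 z, w ∉ range ℓ ∧ LineIndex ℓ w z 0 := by
  filter_upwards [eventually_near_of_isClosed_range h.isClosed_range hz,
    h.isClosed_range.isOpen_compl.mem_nhds hz] with w hw hw'
  refine ⟨hw', _, .of_near h.continuous hw,
    tendsto_log_near (h.tendsto_cocompact.mono_left atBot_le_cocompact) _ _, ?_⟩
  simpa using tendsto_log_near (h.tendsto_cocompact.mono_left atTop_le_cocompact) w z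

end LineIndex

theorem sideIndexOne_iff {ℓ : ℝ → ℂ} {z w : ℂ} :
    SideIndexOne ℓ z w ↔ z ∉ range ℓ ∧ w ∉ range ℓ ∧ LineIndex ℓ z w 1 := by
  simp only [SideIndexOne, LineIndex, LogRatio, Int.cast_one, one_mul]
  simp only [and_assoc]

/-! ### Flat lines and their sides -/

/-- Around each of its points, `C` is a straight line in some chart. -/
def IsFlat (C : Set ℂ) : Prop :=
  ∀ x ∈ C, ∀ O ∈ 𝓝 x, ∃ ψ : ℝ × ℝ → ℂ, IsOpenEmbedding ψ ∧ ψ 0 = x ∧ range ψ ⊆ O ∧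
    ∀ q, ψ q ∈ C ↔ q.1 = 0

/-- `C` is a connected closed set, locally a straight line in suitable charts, whose complement is
made of the open sets `P` and `N`, which are the two sides of `C` at each of its points. -/
structure FlatSides (C P N : Set ℂ) : Prop where
  isClosed : IsClosed C
  isConnected : IsConnected C
  isOpen_left : IsOpen P
  isOpen_right : IsOpen N
  disjoint : Disjoint P N
  union_eq : P ∪ N = Cᶜ
  exists_chart : ∀ x ∈ C, ∀ O ∈ 𝓝 x, ∃ ψ : ℝ × ℝ → ℂ, IsOpenEmbedding ψ ∧ ψ 0 = x ∧
    range ψ ⊆ O ∧ ∀ q, (q.1 < 0 → ψ q ∈ P) ∧ (q.1 = 0 → ψ q ∈ C) ∧ (0 < q.1 → ψ q ∈ N)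

/-- The reflection of the coordinate plane in the vertical axis. -/
def reflectFst : (ℝ × ℝ) ≃ₜ (ℝ × ℝ) := (Homeomorph.neg ℝ).prodCongr (Homeomorph.refl ℝ)

theorem FlatSides.symm {C P N : Set ℂ} (h : FlatSides C P N) : FlatSides C N P := by
  refine ⟨h.isClosed, h.isConnected, h.isOpen_right, h.isOpen_left, h.disjoint.symm,
    (union_comm _ _).trans h.union_eq, fun x hx O hO => ?_⟩
  obtain ⟨ψ, h1, h2, h3, h4⟩ := h.exists_chart x hx O hO
  refine ⟨ψ ∘ reflectFst, h1.comp reflectFst.isOpenEmbedding, ?_,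
    (range_comp_subset_range _ _).trans h3, fun q => ?_⟩
  · rw [← h2]
    exact congrArg ψ (Prod.ext (neg_zero) rfl)
  · obtain ⟨a, b, c⟩ := h4 (reflectFst q)
    refine ⟨fun hq => c ?_, fun hq => b ?_, fun hq => a ?_⟩
    all_goals simpa [reflectFst] using hq

theorem isPreconnected_leftHalf : IsPreconnected {q : ℝ × ℝ | q.1 < 0} :=
  (convex_halfSpace_lt ((LinearMap.fst ℝ ℝ ℝ).isLinear) 0).isPreconnected

theorem isPreconnected_rightHalf : IsPreconnected {q : ℝ × ℝ | 0 < q.1} :=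
  (convex_halfSpace_gt ((LinearMap.fst ℝ ℝ ℝ).isLinear) 0).isPreconnected

namespace IsLine

variable {ℓ : ℝ → ℂ} {z w : ℂ}

/-- The set of points where the index exceeds that of `w` by `n`. -/
def indexSet (ℓ : ℝ → ℂ) (w : ℂ) (n : ℤ) : Set ℂ := {z | z ∉ range ℓ ∧ LineIndex ℓ z w n}

theorem isOpen_indexSet (h : IsLine ℓ) (n : ℤ) : IsOpen (indexSet ℓ w n) := by
  rw [isOpen_iff_mem_nhds]
  rintro z ⟨hz, hn⟩
  filter_upwards [LineIndex.eventually_zero h hz] with x hx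
  refine ⟨hx.1, ?_⟩
  simpa using hx.2.trans hn

theorem eq_of_mem_indexSet (hw : w ∉ range ℓ) {m n : ℤ} (hm : z ∈ indexSet ℓ w m)
    (hn : z ∈ indexSet ℓ w n) : m = n :=
  hm.2.unique hw hn.2

/-- The index is constant on connected sets. -/
theorem subset_indexSet (h : IsLine ℓ) {K : Set ℂ} (hK : IsPreconnected K)
    (hd : Disjoint K (range ℓ)) {n : ℤ} (hz : z ∈ K) (hn : z ∈ indexSet ℓ w n) :
    K ⊆ indexSet ℓ w n := by
  intro x hx
  have : LineIndex ℓ x z 0 := by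
    refine hK.induction₂ (fun a b => LineIndex ℓ a b 0) ?_ ?_ ?_ hx hz
    · intro a ha
      filter_upwards [nhdsWithin_le_nhds (LineIndex.eventually_zero h (disjoint_left.1 hd ha))]
        with b hb
      simpa using hb.2.symm
    · intro a b c _ _ _ h1 h2
      simpa using h1.trans h2
    · intro a b _ _ h1
      simpa using h1.symm
  exact ⟨disjoint_left.1 hd hx, by simpa using this.trans hn.2⟩

/-- Each half of the chart is connected and off the line, so the index is constant on it and one
test point per half decides adherence. -/
theorem mem_closure_indexSet_iff (h : IsLine ℓ) {ψ : ℝ × ℝ → ℂ}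
    (hψ : IsOpenEmbedding ψ) (hC : ∀ q, ψ q ∈ range ℓ ↔ q.1 = 0) (n : ℤ) {q : ℝ × ℝ}
    (hq : q.1 = 0) : ψ q ∈ closure (indexSet ℓ w n) ↔
      (ψ (-1, 0) ∈ indexSet ℓ w n ∨ ψ (1, 0) ∈ indexSet ℓ w n) := by
  have hl : ∀ m, ∀ a : ℝ × ℝ, a.1 < 0 → ψ a ∈ indexSet ℓ w m →
      ψ '' {q : ℝ × ℝ | q.1 < 0} ⊆ indexSet ℓ w m := fun m a ha hm =>
    subset_indexSet h (isPreconnected_leftHalf.image _ hψ.continuous.continuousOn)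
      (by rw [disjoint_left]; rintro _ ⟨b, hb, rfl⟩ hb'; exact hb.ne ((hC b).1 hb')) ⟨a, ha, rfl⟩ hm
  have hr : ∀ m, ∀ a : ℝ × ℝ, 0 < a.1 → ψ a ∈ indexSet ℓ w m →
      ψ '' {q : ℝ × ℝ | 0 < q.1} ⊆ indexSet ℓ w m := fun m a ha hm =>
    subset_indexSet h (isPreconnected_rightHalf.image _ hψ.continuous.continuousOn)
      (by rw [disjoint_left]; rintro _ ⟨b, hb, rfl⟩ hb'; exact hb.ne' ((hC b).1 hb')) ⟨a, ha, rfl⟩ hm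
  constructor
  · intro hcl
    obtain ⟨_, ⟨a, rfl⟩, ha⟩ := mem_closure_iff.1 hcl _ hψ.isOpen_range ⟨q, rfl⟩
    rcases lt_trichotomy a.1 0 with h0 | h0 | h0
    · exact Or.inl (hl n a h0 ha ⟨_, by simp, rfl⟩)
    · exact (ha.1 ((hC a).2 h0)).elim
    · exact Or.inr (hr n a h0 ha ⟨_, by simp, rfl⟩)
  · rintro (hn | hn)
    · have h1 := closure_mono (hl n (-1, 0) (by simp) hn)
      refine h1 (image_closure_subset_closure_image hψ.continuous ⟨q, ?_, rfl⟩)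
      have : closure {q : ℝ × ℝ | q.1 < 0} = {q : ℝ × ℝ | q.1 ≤ 0} := by
        have := isOpenMap_fst (X := ℝ) (Y := ℝ) |>.preimage_closure_eq_closure_preimage
          continuous_fst (Iio (0 : ℝ))
        rw [closure_Iio] at this
        exact this.symm
      rw [this]
      exact hq.le
    · have h1 := closure_mono (hr n (1, 0) (by simp) hn)
      refine h1 (image_closure_subset_closure_image hψ.continuous ⟨q, ?_, rfl⟩)
      have : closure {q : ℝ × ℝ | 0 < q.1} = {q : ℝ × ℝ | 0 ≤ q.1} := by
        have := isOpenMap_fst (X := ℝ) (Y := ℝ) |>.preimage_closure_eq_closure_preimage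
          continuous_fst (Ioi (0 : ℝ))
        rw [closure_Ioi] at this
        exact this.symm
      rw [this]
      exact hq.ge

/-- Every point of a flat line adheres to each of the sets on which the index is constant. -/
theorem range_subset_closure_indexSet (h : IsLine ℓ) (hf : IsFlat (range ℓ)) (hw : w ∉ range ℓ)
    {n : ℤ} (hne : (indexSet ℓ w n).Nonempty) : range ℓ ⊆ closure (indexSet ℓ w n) := by
  have hconn : IsPreconnected (range ℓ) := isPreconnected_range h.continuous
  -- The chart criterion does not depend on the point of the line inside the chart, so adherence is
  -- locally constant along the connected line. If it failed at one point it would fail at all, and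
  -- the index set would be clopen.
  have hloc : ∀ x ∈ range ℓ, ∀ᶠ y in 𝓝[range ℓ] x,
      (x ∈ closure (indexSet ℓ w n) ↔ y ∈ closure (indexSet ℓ w n)) := by
    intro x hx
    obtain ⟨ψ, hψ, rfl, -, hC⟩ := hf x hx univ univ_mem
    filter_upwards [nhdsWithin_le_nhds (hψ.isOpen_range.mem_nhds ⟨0, rfl⟩), self_mem_nhdsWithin]
    rintro _ ⟨q, rfl⟩ hq
    rw [mem_closure_indexSet_iff h hψ hC n rfl,
      mem_closure_indexSet_iff h hψ hC n ((hC q).1 hq)]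
  have hall : ∀ {x y}, x ∈ range ℓ → y ∈ range ℓ →
      (x ∈ closure (indexSet ℓ w n) ↔ y ∈ closure (indexSet ℓ w n)) := fun hx hy =>
    hconn.induction₂ (fun x y => (x ∈ closure (indexSet ℓ w n) ↔ y ∈ closure (indexSet ℓ w n)))
      hloc (fun _ _ _ _ _ _ => Iff.trans) (fun _ _ _ _ => Iff.symm) hx hy
  by_contra hcon
  obtain ⟨x, hx, hxc⟩ := not_subset.1 hcon
  have hcl : IsClosed (indexSet ℓ w n) := by
    refine isClosed_of_closure_subset fun y hy => ?_
    have hyC : y ∉ range ℓ := fun hyC => hxc ((hall hx hyC).2 hy)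
    obtain ⟨m, hm⟩ := LineIndex.exists_of_notMem h hyC hw
    obtain ⟨a, ha, ha'⟩ := mem_closure_iff.1 hy _ (isOpen_indexSet h m) ⟨hyC, hm⟩
    exact ⟨hyC, eq_of_mem_indexSet hw ha ha' ▸ hm⟩
  have := IsClopen.eq_univ ⟨hcl, isOpen_indexSet h n⟩ hne
  exact (this ▸ mem_univ x : x ∈ indexSet ℓ w n).1 hx

/-- Every value of the index adheres to the line and therefore occupies one of the two halves of a
chart. The values 0 and 1 already occupy both, which leaves no room for a third. -/
theorem left_right_eq (h : IsLine ℓ) (hf : IsFlat (range ℓ)) (h1 : SideIndexOne ℓ z w) :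
    leftSide ℓ = indexSet ℓ w 1 ∧ rightSide ℓ = indexSet ℓ w 0 ∧
      indexSet ℓ w 1 ∪ indexSet ℓ w 0 = (range ℓ)ᶜ := by
  rw [sideIndexOne_iff] at h1
  obtain ⟨hz, hw, hi⟩ := h1
  have hw0 : w ∈ indexSet ℓ w 0 := ⟨hw, 0, .refl _ _, tendsto_const_nhds, by
    rw [Int.cast_zero, zero_mul]
    exact tendsto_const_nhds⟩
  have key : ∀ x ∉ range ℓ, x ∈ indexSet ℓ w 1 ∪ indexSet ℓ w 0 := by
    intro x hx
    obtain ⟨m, hm⟩ := LineIndex.exists_of_notMem h hx hw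
    have hm' : x ∈ indexSet ℓ w m := ⟨hx, hm⟩
    obtain ⟨ψ, hψ, e, -, hC⟩ := hf (ℓ 0) ⟨0, rfl⟩ univ univ_mem
    have cl : ∀ k y, y ∈ indexSet ℓ w k →
        (ψ (-1, 0) ∈ indexSet ℓ w k ∨ ψ (1, 0) ∈ indexSet ℓ w k) := fun k y hy =>
      (mem_closure_indexSet_iff h hψ hC k (q := 0) rfl).1
        (range_subset_closure_indexSet h hf hw ⟨y, hy⟩ (e ▸ ⟨0, rfl⟩))
    have c0 := cl 0 w hw0
    have c1 := cl 1 z ⟨hz, hi⟩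
    have cm := cl m x hm'
    have U : ∀ y {a b : ℤ}, y ∈ indexSet ℓ w a → y ∈ indexSet ℓ w b → a = b :=
      fun y _ _ => eq_of_mem_indexSet hw
    have : m = 1 ∨ m = 0 := by
      rcases c0 with c0 | c0 <;> rcases c1 with c1 | c1 <;> rcases cm with cm | cm
      all_goals first
        | exact Or.inl (U _ cm c1)
        | exact Or.inr (U _ cm c0)
        | exact absurd (U _ c0 c1) (by norm_num)
    rcases this with rfl | rfl
    · exact Or.inl hm'
    · exact Or.inr hm'
  refine ⟨subset_antisymm ?_ ?_, subset_antisymm ?_ ?_, subset_antisymm ?_ key⟩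
  · rintro x ⟨y, hy⟩
    rw [sideIndexOne_iff] at hy
    rcases key x hy.1 with hx | hx
    · exact hx
    · rcases key y hy.2.1 with hy' | hy'
      · exact absurd (hx.2.unique hw (hy.2.2.trans hy'.2)) (by norm_num)
      · exact absurd (hx.2.unique hw (hy.2.2.trans hy'.2)) (by norm_num)
  · rintro x hx
    exact ⟨w, sideIndexOne_iff.2 ⟨hx.1, hw, hx.2⟩⟩
  · rintro y ⟨x, hy⟩
    rw [sideIndexOne_iff] at hy
    rcases key y hy.2.1 with hy' | hy'
    · rcases key x hy.1 with hx | hx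
      · exact absurd (hx.2.unique hw (hy.2.2.trans hy'.2)) (by norm_num)
      · exact absurd (hx.2.unique hw (hy.2.2.trans hy'.2)) (by norm_num)
    · exact hy'
  · rintro x hx
    exact ⟨z, sideIndexOne_iff.2 ⟨hz, hx.1, by simpa using hi.trans hx.2.symm⟩⟩
  · exact union_subset (fun x hx => hx.1) fun x hx => hx.1

theorem sideIndexOne_of_mem (h : IsLine ℓ) (hf : IsFlat (range ℓ)) (hz : z ∈ leftSide ℓ)
    (hw : w ∈ rightSide ℓ) : SideIndexOne ℓ z w := by
  obtain ⟨w', hw'⟩ := hz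
  obtain ⟨e1, e0, -⟩ := left_right_eq h hf hw'
  rw [e0] at hw
  have := sideIndexOne_iff.1 hw'
  exact sideIndexOne_iff.2 ⟨this.1, hw.1, by simpa using this.2.2.trans hw.2.symm⟩

theorem flatSides (h : IsLine ℓ) (hf : IsFlat (range ℓ)) (hne : (leftSide ℓ).Nonempty) :
    FlatSides (range ℓ) (leftSide ℓ) (rightSide ℓ) := by
  obtain ⟨z, w, hzw⟩ := hne
  obtain ⟨e1, e0, hu⟩ := left_right_eq h hf hzw
  have hw := hzw.2.1
  have hw0 : w ∈ indexSet ℓ w 0 := e0 ▸ ⟨z, hzw⟩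
  have hz1 : z ∈ indexSet ℓ w 1 := e1 ▸ ⟨w, hzw⟩
  have hU : ∀ {y} {a b : ℤ}, y ∈ indexSet ℓ w a → y ∈ indexSet ℓ w b → a = b :=
    fun {y _ _} => eq_of_mem_indexSet hw
  rw [e1, e0]
  refine ⟨h.isClosed_range, isConnected_range h.continuous, isOpen_indexSet h 1,
    isOpen_indexSet h 0, ?_, hu, fun x hx O hO => ?_⟩
  · rw [disjoint_left]
    exact fun x h1 h0 => absurd (hU h1 h0) (by norm_num)
  · obtain ⟨ψ, hψ, rfl, hsub, hC⟩ := hf x hx O hO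
    have side : ∀ m : ℤ, ∀ S : Set (ℝ × ℝ), IsPreconnected S → (∀ q ∈ S, q.1 ≠ 0) → ∀ a ∈ S,
        ψ a ∈ indexSet ℓ w m → ∀ q ∈ S, ψ q ∈ indexSet ℓ w m := fun m S hS h0 a ha hm q hq =>
      subset_indexSet h (hS.image _ hψ.continuous.continuousOn)
        (by rw [disjoint_left]; rintro _ ⟨b, hb, rfl⟩ hb'; exact h0 b hb ((hC b).1 hb'))
        ⟨a, ha, rfl⟩ hm ⟨q, hq, rfl⟩
    have hl := fun m => side m _ isPreconnected_leftHalf (fun q hq => ne_of_lt hq) (-1, 0) (by simp)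
    have hr := fun m => side m _ isPreconnected_rightHalf (fun q hq => ne_of_gt hq) (1, 0) (by simp)
    have c0 := (mem_closure_indexSet_iff h hψ hC 0 (q := 0) rfl).1
        (range_subset_closure_indexSet h hf hw ⟨w, hw0⟩ hx)
    have c1 := (mem_closure_indexSet_iff h hψ hC 1 (q := 0) rfl).1
        (range_subset_closure_indexSet h hf hw ⟨z, hz1⟩ hx)
    rcases c1 with c1 | c1
    · have c0 : ψ (1, 0) ∈ indexSet ℓ w 0 := c0.resolve_left fun c => absurd (hU c c1) (by norm_num)
      exact ⟨ψ, hψ, rfl, hsub, fun q => ⟨hl 1 c1 q, (hC q).2, hr 0 c0 q⟩⟩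
    -- The chart has index one on its right half: reflecting it restores the convention that the
    -- left side comes first.
    · have c0 : ψ (-1, 0) ∈ indexSet ℓ w 0 := c0.resolve_right fun c => absurd (hU c c1) (by norm_num)
      refine ⟨ψ ∘ reflectFst, hψ.comp reflectFst.isOpenEmbedding,
        congrArg ψ (Prod.ext (neg_zero) rfl), (range_comp_subset_range _ _).trans hsub, fun q =>
        ⟨fun hq => hr 1 c1 (reflectFst q) ?_, fun hq => (hC _).2 ?_,
          fun hq => hl 0 c0 (reflectFst q) ?_⟩⟩
      all_goals simpa [reflectFst] using hq

end IsLine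

/-! ### Leaves are flat -/

namespace OrientedFoliation

variable (F : OrientedFoliation)

/-- A chart with values in the whole coordinate plane, centered at the given point and contained in
the given neighborhood. -/
theorem _root_.OpenPartialHomeomorph.exists_isOpenEmbedding (e : OpenPartialHomeomorph ℂ (ℝ × ℝ))
    (ht : e.target = univ) {x : ℂ} (hx : x ∈ e.source) {O : Set ℂ} (hO : O ∈ 𝓝 x) :
    ∃ ψ : ℝ × ℝ → ℂ, IsOpenEmbedding ψ ∧ ψ 0 = x ∧ range ψ ⊆ O ∧ range ψ ⊆ e.source ∧
      ∀ q, (e (ψ q)).1 = (e x).1 ↔ q.1 = 0 := by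
  have hs : e.symm ⁻¹' O ∈ 𝓝 (e x) := by
    refine (e.symm.continuousAt (by simp [ht])).preimage_mem_nhds ?_
    rwa [e.left_inv hx]
  obtain ⟨r, hr, hball⟩ := Metric.mem_nhds_iff.1 hs
  let b : ℝ × ℝ → ℝ × ℝ := fun q => e x + r • OpenPartialHomeomorph.univUnitBall q
  have h1 : IsOpenEmbedding (OpenPartialHomeomorph.univUnitBall : ℝ × ℝ → ℝ × ℝ) :=
    OpenPartialHomeomorph.univUnitBall.isOpenEmbedding rfl
  have hb : IsOpenEmbedding b :=
    ((Homeomorph.addLeft (e x)).isOpenEmbedding.comp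
      (Homeomorph.smulOfNeZero r hr.ne').isOpenEmbedding).comp h1
  have he : IsOpenEmbedding e.symm := e.symm.isOpenEmbedding ht
  have hbr : ∀ q, b q ∈ Metric.ball (e x) r := by
    intro q
    have : OpenPartialHomeomorph.univUnitBall q ∈ Metric.ball (0 : ℝ × ℝ) 1 :=
      OpenPartialHomeomorph.univUnitBall.map_source (mem_univ q)
    rw [mem_ball_zero_iff] at this
    simp only [b, mem_ball_iff_norm, add_sub_cancel_left, norm_smul, Real.norm_of_nonneg hr.le]
    exact mul_lt_of_lt_one_right hr this
  refine ⟨e.symm ∘ b, he.comp hb, ?_, ?_, ?_, fun q => ?_⟩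
  · simp [b, OpenPartialHomeomorph.univUnitBall_apply_zero, e.left_inv hx]
  · rintro _ ⟨q, rfl⟩
    exact hball (hbr q)
  · rintro _ ⟨q, rfl⟩
    exact e.map_target (by simp [ht])
  · rw [Function.comp_apply, e.right_inv (by simp [ht])]
    have : 0 < (√(1 + ‖q‖ ^ 2))⁻¹ := by positivity
    simp [b, OpenPartialHomeomorph.univUnitBall_apply, hr.ne', this.ne']

/-- The chart condition puts all points of one vertical on a single leaf, in the order of their
heights. -/
theorem exists_param_lt {e : OpenPartialHomeomorph ℂ (ℝ × ℝ)} (ht : e.target = univ)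
    (he : ∀ u ∈ e.source, ∀ v ∈ e.source, (e u).1 = (e v).1 → (e u).2 < (e v).2 →
        ∃ s t : ℝ, s < t ∧ F.leaf u s = u ∧ F.leaf u t = v) {z : ℂ} (hz : z ∈ e.source) :
    ∃ τ : ℝ → ℝ, StrictMono τ ∧ ∀ y, F.leaf z (τ y) = e.symm ((e z).1, y) := by
  have hsrc : ∀ y, e.symm ((e z).1, y) ∈ e.source := fun y => e.map_target (by simp [ht])
  have heq : ∀ y, e (e.symm ((e z).1, y)) = ((e z).1, y) := fun y => e.right_inv (by simp [ht])
  have hlt : ∀ y y', y < y' → ∃ s t : ℝ, s < t ∧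
      F.leaf (e.symm ((e z).1, y)) s = e.symm ((e z).1, y) ∧
      F.leaf (e.symm ((e z).1, y)) t = e.symm ((e z).1, y') := fun y y' h =>
    he _ (hsrc y) _ (hsrc y') (by rw [heq, heq]) (by rw [heq, heq]; exact h)
  have hz' : e.symm ((e z).1, (e z).2) = z := e.left_inv hz
  have hleaf : ∀ y, F.leaf (e.symm ((e z).1, y)) = F.leaf z := by
    intro y
    rcases lt_trichotomy y (e z).2 with h | h | h
    · obtain ⟨s, t, -, -, h2⟩ := hlt y _ h
      rw [hz'] at h2
      exact (F.leaf_eq _ _ ⟨t, h2⟩).symm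
    · rw [h, hz']
    · obtain ⟨s, t, -, -, h2⟩ := hlt _ y h
      rw [hz'] at h2
      exact F.leaf_eq _ _ ⟨t, h2⟩
  have hex : ∀ y, ∃ t, F.leaf z t = e.symm ((e z).1, y) := fun y => by
    rw [← hleaf y]
    exact F.mem_leaf _
  choose τ hτ using hex
  refine ⟨τ, fun y y' h => ?_, hτ⟩
  obtain ⟨s, t, hst, h1, h2⟩ := hlt y y' h
  rw [hleaf, ← hτ] at h1 h2
  rwa [← (F.isLine_leaf z).injective h1, ← (F.isLine_leaf z).injective h2]

/-- The leaf is embedded, so near `x` it only takes parameters close to that of `x`. By the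
intermediate value theorem these parameters belong to the vertical through `x`: other returns of the
leaf to the chart stay away from `x`. -/
theorem isFlat_leaf (z : ℂ) : IsFlat (range (F.leaf z)) := by
  intro x hx O hO
  rw [← F.leaf_eq z x hx]
  obtain ⟨e, hxe, ht, he⟩ := F.exists_chart x
  obtain ⟨τ, hmono, hτ⟩ := F.exists_param_lt ht he hxe
  have hl := F.isLine_leaf x
  -- near `x`, the leaf is contained in the vertical of the chart
  obtain ⟨G, hG, hGe⟩ := hl.isInducing.isOpen_iff.1
    (isOpen_Ioo : IsOpen (Ioo (τ ((e x).2 - 1)) (τ ((e x).2 + 1))))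
  have hxG : x ∈ G := by
    have h1 : F.leaf x (τ (e x).2) = x := by rw [hτ]; exact e.left_inv hxe
    have h2 : τ (e x).2 ∈ F.leaf x ⁻¹' G := by
      rw [hGe]
      exact ⟨hmono (by linarith), hmono (by linarith)⟩
    rwa [mem_preimage, h1] at h2
  obtain ⟨ψ, hψ, h0, hsub, hsrc, hiff⟩ :=
    e.exists_isOpenEmbedding ht hxe (inter_mem hO (hG.mem_nhds hxG))
  refine ⟨ψ, hψ, h0, hsub.trans inter_subset_left, fun q => ?_⟩
  rw [← hiff q]
  constructor
  · rintro ⟨t, htq⟩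
    have h1 : t ∈ Ioo (τ ((e x).2 - 1)) (τ ((e x).2 + 1)) := by
      rw [← hGe, mem_preimage, htq]
      exact (hsub ⟨q, rfl⟩).2
    have hcont : Continuous fun y => e.symm ((e x).1, y) := by
      have : Continuous e.symm := (e.symm.isOpenEmbedding ht).continuous
      fun_prop
    have hτc : Continuous τ := by
      rw [hl.isInducing.continuous_iff]
      exact hcont.congr fun y => (hτ y).symm
    obtain ⟨y, -, hy⟩ := intermediate_value_Icc (by linarith) hτc.continuousOn
      (Ioo_subset_Icc_self h1)
    rw [← htq, ← hy, hτ, e.right_inv (by simp [ht])]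
  · intro h
    refine ⟨τ (e (ψ q)).2, ?_⟩
    rw [hτ, ← h]
    exact e.left_inv (hsrc ⟨q, rfl⟩)

theorem flatSides_leaf {z : ℂ} (hne : (leftSide (F.leaf z)).Nonempty) :
    FlatSides (range (F.leaf z)) (leftSide (F.leaf z)) (rightSide (F.leaf z)) :=
  (F.isLine_leaf z).flatSides (F.isFlat_leaf z) hne

end OrientedFoliation

/-! ### Connectedness of the sides of a flat line -/

namespace FlatSides

variable {C P N : Set ℂ}

theorem compl_right (h : FlatSides C P N) : Nᶜ = P ∪ C := by
  ext z
  have h1 : z ∈ P ∪ N ↔ z ∉ C := by rw [h.union_eq, mem_compl_iff]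
  have h2 : z ∈ P → z ∉ N := fun hP hN => disjoint_left.1 h.disjoint hP hN
  simp only [mem_union, mem_compl_iff] at *
  tauto

theorem isClosed_left (h : FlatSides C P N) : IsClosed (P ∪ C) :=
  h.compl_right ▸ h.isOpen_right.isClosed_compl

theorem disjoint_right_line (h : FlatSides C P N) : Disjoint N C :=
  disjoint_left.2 fun _ hz hC => (h.compl_right ▸ Or.inr hC : _ ∈ Nᶜ) hz

theorem cases (h : FlatSides C P N) (z : ℂ) : z ∈ P ∨ z ∈ C ∨ z ∈ N := by
  by_cases hz : z ∈ N
  · exact Or.inr (Or.inr hz)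
  · have : z ∈ P ∪ C := h.compl_right ▸ hz
    exact this.imp_right Or.inl

theorem subset_closure_right (h : FlatSides C P N) : C ⊆ closure N := by
  intro x hx
  rw [mem_closure_iff_nhds]
  intro O hO
  obtain ⟨ψ, -, -, hsub, hψ⟩ := h.exists_chart x hx O hO
  exact ⟨ψ (1, 0), hsub ⟨_, rfl⟩, (hψ _).2.2 (by simp)⟩

/-- A locally constant function on the right side extends over the line and its left side. -/
theorem isPreconnected_inter_right (h : FlatSides C P N) {O : Set ℂ} (hO : IsOpen O)
    (hOc : IsPreconnected O) (hCO : P ∪ C ⊆ O) : IsPreconnected (O ∩ N) := by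
  classical
  refine isPreconnected_of_forall_constant fun f hf => ?_
  have hne : ∀ x ∈ C, (𝓝[N] x).NeBot := fun x hx =>
    mem_closure_iff_nhdsWithin_neBot.1 (h.subset_closure_right hx)
  -- The value taken by `f` just to the right of a point of `C` is locally constant along `C`, as
  -- half of a chart shows. Since `C` is connected there is one such value `b`, which extends `f`
  -- over `C` and `P`.
  have hloc : ∀ x ∈ C, ∀ᶠ y in 𝓝[C] x, ∃ b : Bool,
      (∀ᶠ z in 𝓝[N] x, f z = b) ∧ (∀ᶠ z in 𝓝[N] y, f z = b) := by
    intro x hx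
    obtain ⟨ψ, hψ, rfl, hsub, hs⟩ := h.exists_chart x hx O (hO.mem_nhds (hCO (Or.inr hx)))
    have hc : ∀ q : ℝ × ℝ, 0 < q.1 → f (ψ q) = f (ψ (1, 0)) := fun q hq =>
      isPreconnected_rightHalf.constant_of_mapsTo (f := f ∘ ψ) (x := q) (y := (1, 0)) .univ
        (hf.comp hψ.continuous.continuousOn fun a ha => ⟨hsub ⟨a, rfl⟩, (hs a).2.2 ha⟩)
        (fun _ _ => mem_univ _) hq (by simp)
    have key : ∀ q, ∀ᶠ z in 𝓝[N] (ψ q), f z = f (ψ (1, 0)) := by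
      intro q
      filter_upwards [nhdsWithin_le_nhds (hψ.isOpen_range.mem_nhds ⟨q, rfl⟩), self_mem_nhdsWithin]
      rintro _ ⟨a, rfl⟩ ha
      refine hc a ?_
      by_contra hcon
      rcases (not_lt.1 hcon).lt_or_eq with h1 | h1
      · exact disjoint_left.1 h.disjoint ((hs a).1 h1) ha
      · exact disjoint_left.1 h.disjoint_right_line ha ((hs a).2.1 h1)
    filter_upwards [nhdsWithin_le_nhds (hψ.isOpen_range.mem_nhds ⟨0, rfl⟩)]
    rintro _ ⟨q, rfl⟩
    exact ⟨_, key 0, key q⟩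
  have hall : ∀ {x y}, x ∈ C → y ∈ C → ∃ b : Bool,
      (∀ᶠ z in 𝓝[N] x, f z = b) ∧ (∀ᶠ z in 𝓝[N] y, f z = b) := fun hx hy =>
    h.isConnected.isPreconnected.induction₂ (fun x y => ∃ b : Bool,
      (∀ᶠ z in 𝓝[N] x, f z = b) ∧ (∀ᶠ z in 𝓝[N] y, f z = b)) hloc
      (by
        rintro x y z - hy - ⟨b, h1, h2⟩ ⟨c, h3, h4⟩
        have := hne y hy
        obtain ⟨w, hw, hw'⟩ := (h2.and h3).exists
        exact ⟨b, h1, by rwa [← hw, hw']⟩)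
      (fun x y _ _ ⟨b, h1, h2⟩ => ⟨b, h2, h1⟩) hx hy
  obtain ⟨x₀, hx₀⟩ := h.isConnected.nonempty
  obtain ⟨b, hb, -⟩ := hall hx₀ hx₀
  have hb' : ∀ y ∈ C, ∀ᶠ z in 𝓝[N] y, f z = b := by
    intro y hy
    obtain ⟨c, h1, h2⟩ := hall hx₀ hy
    have := hne x₀ hx₀
    obtain ⟨w, hw, hw'⟩ := (hb.and h1).exists
    rwa [← hw, hw']
  let g : ℂ → Bool := fun z => if z ∈ N then f z else b
  have hg : ContinuousOn g O := by
    intro z hz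
    refine ContinuousAt.continuousWithinAt ?_
    rcases h.cases z with hz' | hz' | hz'
    · have : g =ᶠ[𝓝 z] fun _ => b := by
        filter_upwards [h.isOpen_left.mem_nhds hz'] with w hw
        simp [g, disjoint_left.1 h.disjoint hw]
      exact this.continuousAt
    · have : g =ᶠ[𝓝 z] fun _ => b := by
        filter_upwards [eventually_nhdsWithin_iff.1 (hb' z hz')] with w hw
        by_cases hw' : w ∈ N
        · simp [g, hw', hw hw']
        · simp [g, hw']
      exact this.continuousAt
    · have : g =ᶠ[𝓝 z] f := by
        filter_upwards [h.isOpen_right.mem_nhds hz'] with w hw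
        simp [g, hw]
      exact ((hf z ⟨hz, hz'⟩).continuousAt
        ((hO.inter h.isOpen_right).mem_nhds ⟨hz, hz'⟩)).congr this.symm
  intro x hx y hy
  have := hOc.constant_of_mapsTo .univ hg (fun _ _ => mem_univ _) hx.1 hy.1
  simpa [g, hx.2, hy.2] using this

theorem isPreconnected_right (h : FlatSides C P N) : IsPreconnected N := by
  simpa using h.isPreconnected_inter_right isOpen_univ isPreconnected_univ (subset_univ _)

theorem isPreconnected_right_union (h : FlatSides C P N) {J : Set ℂ} (hJ : J ⊆ C) :
    IsPreconnected (N ∪ J) :=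
  h.isPreconnected_right.subset_closure subset_union_left
    (union_subset subset_closure (hJ.trans h.subset_closure_right))

theorem closure_right (h : FlatSides C P N) : closure N = N ∪ C :=
  subset_antisymm (closure_minimal subset_union_left h.symm.isClosed_left)
    (union_subset subset_closure h.subset_closure_right)

theorem nonempty_right (h : FlatSides C P N) : N.Nonempty := by
  obtain ⟨x, hx⟩ := h.isConnected.nonempty
  exact closure_nonempty_iff.1 ⟨x, h.subset_closure_right hx⟩

/-- A connected set off the line lies on one side of it. -/
theorem subset_right (h : FlatSides C P N) {K : Set ℂ} (hK : IsPreconnected K)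
    (hd : Disjoint K C) (hne : (K ∩ N).Nonempty) : K ⊆ N := by
  refine hK.subset_right_of_subset_union h.isOpen_left h.isOpen_right h.disjoint ?_ hne
  rw [h.union_eq]
  exact disjoint_left.1 hd

theorem subset_or_subset (h : FlatSides C P N) {K : Set ℂ} (hK : IsPreconnected K)
    (hd : Disjoint K C) : K ⊆ P ∨ K ⊆ N := by
  rcases K.eq_empty_or_nonempty with rfl | ⟨x, hx⟩
  · exact Or.inl (empty_subset _)
  · rcases h.cases x with h1 | h1 | h1
    · exact Or.inl (h.symm.subset_right hK hd ⟨x, hx, h1⟩)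
    · exact (disjoint_left.1 hd hx h1).elim
    · exact Or.inr (h.subset_right hK hd ⟨x, hx, h1⟩)

end FlatSides

/-! ### Homogeneity of connected open sets -/

/-- The translation by `d - c` is damped by a tent function with Lipschitz constant 1/r. The result
differs from the identity by a map with Lipschitz constant ‖d - c‖/r < 1, hence is a homeomorphism.
-/
theorem exists_homeomorph_ball {c d : ℂ} {r : ℝ} (hd : d ∈ Metric.ball c r) :
    ∃ h : ℂ ≃ₜ ℂ, h c = d ∧ ∀ z ∉ Metric.ball c r, h z = z := by
  have hr : 0 < r := Metric.pos_of_mem_ball hd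
  rw [mem_ball_iff_norm] at hd
  let k : ℝ := ‖d - c‖ / r
  have hk : k < 1 := (div_lt_one hr).2 hd
  let φ : ℂ → ℝ := fun z => max 0 (1 - ‖z - c‖ / r)
  have hφ : ∀ z w, |φ z - φ w| ≤ ‖z - w‖ / r := by
    intro z w
    have h1 : |φ z - φ w| ≤ |(1 - ‖z - c‖ / r) - (1 - ‖w - c‖ / r)| := by
      have := abs_max_sub_max_le_max 0 (1 - ‖z - c‖ / r) 0 (1 - ‖w - c‖ / r)
      simpa using this
    refine h1.trans ?_
    have h2 : (1 - ‖z - c‖ / r) - (1 - ‖w - c‖ / r) = (‖w - c‖ - ‖z - c‖) / r := by ring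
    rw [h2, abs_div, abs_of_pos hr]
    have := abs_norm_sub_norm_le (w - c) (z - c)
    rw [sub_sub_sub_cancel_right, norm_sub_rev w z] at this
    gcongr
  let f : ℂ → ℂ := fun z => z + φ z • (d - c)
  have happ : ApproximatesLinearOn f ((ContinuousLinearEquiv.refl ℝ ℂ : ℂ ≃L[ℝ] ℂ) : ℂ →L[ℝ] ℂ) univ
      (⟨k, by positivity⟩ : NNReal) := by
    intro z _ w _
    have : f z - f w - ((ContinuousLinearEquiv.refl ℝ ℂ : ℂ ≃L[ℝ] ℂ) : ℂ →L[ℝ] ℂ) (z - w) =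
        (φ z - φ w) • (d - c) := by
      simp [f]
      ring
    rw [this, norm_smul, Real.norm_eq_abs]
    calc |φ z - φ w| * ‖d - c‖ ≤ ‖z - w‖ / r * ‖d - c‖ := by gcongr; exact hφ z w
      _ = k * ‖z - w‖ := by simp only [k]; ring
  refine ⟨happ.toHomeomorph f (Or.inr ?_), ?_, fun z hz => ?_⟩
  · have h1 : ‖((ContinuousLinearEquiv.refl ℝ ℂ).symm : ℂ →L[ℝ] ℂ)‖₊ = 1 := by
      ext
      simp
    rw [h1, inv_one]
    exact hk
  · change f c = d
    simp [f, φ]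
  · change f z = z
    have : φ z = 0 := by
      rw [mem_ball_iff_norm, not_lt] at hz
      exact max_eq_left (sub_nonpos.2 ((one_le_div hr).2 hz))
    simp [f, this]

/-- Any point of a connected open set can be moved to any other by a homeomorphism of the plane
supported in this set. -/
theorem exists_homeomorph_of_isPreconnected {S : Set ℂ} (hS : IsOpen S) (hc : IsPreconnected S)
    {c d : ℂ} (hcS : c ∈ S) (hdS : d ∈ S) : ∃ h : ℂ ≃ₜ ℂ, h c = d ∧ ∀ z ∉ S, h z = z := by
  refine hc.induction₂ (fun c d => ∃ h : ℂ ≃ₜ ℂ, h c = d ∧ ∀ z ∉ S, h z = z) ?_ ?_ ?_ hcS hdS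
  · intro x hx
    obtain ⟨r, hr, hb⟩ := Metric.isOpen_iff.1 hS x hx
    filter_upwards [nhdsWithin_le_nhds (Metric.ball_mem_nhds x hr)] with y hy
    obtain ⟨h, h1, h2⟩ := exists_homeomorph_ball hy
    exact ⟨h, h1, fun z hz => h2 z fun hz' => hz (hb hz')⟩
  · rintro x y z - - - ⟨h, h1, h2⟩ ⟨k, k1, k2⟩
    exact ⟨h.trans k, by simp [h1, k1], fun w hw => by simp [h2 w hw, k2 w hw]⟩
  · rintro x y - - ⟨h, h1, h2⟩
    exact ⟨h.symm, by simp [← h1], fun w hw => by rw [h.symm_apply_eq, h2 w hw]⟩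

/-! ### Disjoint paths between three lines -/

theorem Path.trans_apply_of_mem_Ioo {X : Type*} [TopologicalSpace X] {x y z : X} (p : Path x y)
    (q : Path y z) {t : unitInterval} (ht : t ∈ Ioo (0 : unitInterval) 1) :
    (∃ s ≠ 0, p.trans q t = p s) ∨ ∃ s ≠ 1, p.trans q t = q s := by
  rw [Path.trans_apply]
  split_ifs with h
  · refine Or.inl ⟨_, fun h0 => ?_, rfl⟩
    have h1 : (2 * (t : ℝ)) = 0 := congrArg Subtype.val h0
    have h2 : (0 : ℝ) < t := ht.1
    linarith
  · refine Or.inr ⟨_, fun h0 => ?_, rfl⟩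
    have h1 : (2 * (t : ℝ) - 1) = 1 := congrArg Subtype.val h0
    have h2 : (t : ℝ) < 1 := ht.2
    linarith

/-- A path that enters a half disk based on a line, followed until it hits the half disk and then
along the half disk to the line. -/
theorem exists_path_drop {ψ : ℝ × ℝ → ℂ} (hψ : IsOpenEmbedding ψ) {S C : Set ℂ}
    (hS : ∀ q : ℝ × ℝ, 0 < q.1 → ψ q ∈ S) (hC : ∀ q : ℝ × ℝ, q.1 = 0 → ψ q ∈ C)
    (hSC : Disjoint S C) {x d : ℂ} (b : Path x d) (hb : ∀ t, t ≠ 0 → b t ∈ S) (hxS : x ∉ S)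
    (hxC : x ∉ C) {D : Set ℂ} (hD : D = ψ '' {q | 0 ≤ q.1 ∧ q.1 ^ 2 + q.2 ^ 2 ≤ 1})
    (hd : d ∈ D) :
    ∃ X Y : ℝ, 0 < X ∧ X ^ 2 + Y ^ 2 = 1 ∧ ψ (X, Y) ∈ range b ∧ ∃ α : Path x (ψ (0, Y)),
      (∀ t ∈ Ioo (0 : unitInterval) 1, α t ∈ S) ∧
      range α ⊆ (range b \ D) ∪ (fun X' => ψ (X', Y)) '' Icc 0 X := by
  have hDcl : IsClosed D := by
    rw [hD]
    refine IsCompact.isClosed (IsCompact.image ?_ hψ.continuous)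
    refine Metric.isCompact_of_isClosed_isBounded ?_ ?_
    · exact (isClosed_le continuous_const continuous_fst).inter
        (isClosed_le ((continuous_fst.pow 2).add (continuous_snd.pow 2)) continuous_const)
    · refine (Metric.isBounded_closedBall (x := (0 : ℝ × ℝ)) (r := 1)).subset ?_
      rintro q ⟨-, hq⟩
      rw [mem_closedBall_zero_iff, Prod.norm_def, max_le_iff, Real.norm_eq_abs, Real.norm_eq_abs]
      constructor <;> rw [abs_le] <;> constructor <;> nlinarith
  obtain ⟨τ, hτ, hmin⟩ : ∃ τ, IsLeast (b ⁻¹' D) τ :=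
    (hDcl.preimage b.continuous).isCompact.exists_isLeast ⟨1, by simpa using hd⟩
  have hmin' : ∀ t < τ, b t ∉ D := fun t ht h => (hmin h).not_gt ht
  have hx : x ∉ D := by
    rw [hD]
    rintro ⟨q, ⟨h1, -⟩, rfl⟩
    rcases h1.lt_or_eq with h1 | h1
    · exact hxS (hS q h1)
    · exact hxC (hC q h1.symm)
  have hτ0 : τ ≠ 0 := by
    rintro rfl
    exact hx (by simpa using hτ)
  have hτD : b τ ∈ D := hτ
  rw [hD] at hτD
  obtain ⟨⟨X, Y⟩, ⟨hX0, hle⟩, hXY⟩ := hτD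
  simp only at hX0 hle
  have hX : 0 < X := hX0.lt_of_ne fun h =>
    disjoint_left.1 hSC (hb τ hτ0) (hXY ▸ hC (X, Y) h.symm)
  -- At the first hitting time the path is on the circular arc: a point of the open half disk would
  -- be preceded by other points of `D`. On the arc the height `Y` determines `X`, which keeps two
  -- such drops apart.
  have h1 : X ^ 2 + Y ^ 2 = 1 := by
    refine hle.eq_of_not_lt fun hlt => ?_
    let Q : Set (ℝ × ℝ) := {q | 0 < q.1 ∧ q.1 ^ 2 + q.2 ^ 2 < 1}
    have hQ : IsOpen Q := (isOpen_lt continuous_const continuous_fst).inter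
      (isOpen_lt ((continuous_fst.pow 2).add (continuous_snd.pow 2)) continuous_const)
    have h2 : τ ∈ closure (Iio τ) := by
      have : (Iio τ).Nonempty := ⟨0, unitInterval.pos_iff_ne_zero.2 hτ0⟩
      rw [closure_Iio' this]
      exact self_mem_Iic
    obtain ⟨t, ht, ht'⟩ := mem_closure_iff.1 h2 (b ⁻¹' (ψ '' Q))
      ((hψ.isOpenMap Q hQ).preimage b.continuous) ⟨(X, Y), ⟨hX, hlt⟩, hXY⟩
    refine hmin' t ht' ?_
    rw [hD]
    obtain ⟨q, hq, e⟩ := ht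
    exact ⟨q, ⟨hq.1.le, hq.2.le⟩, e⟩
  let p₁ : Path x (ψ (X, Y)) := ⟨⟨fun s => b (s * τ), by fun_prop⟩, by simp, by simp [hXY]⟩
  let p₂ : Path (ψ (X, Y)) (ψ (0, Y)) :=
    ⟨⟨fun s => ψ ((1 - s) * X, Y), hψ.continuous.comp (by fun_prop)⟩, by simp, by simp⟩
  refine ⟨X, Y, hX, h1, ⟨τ, hXY.symm⟩, p₁.trans p₂, fun t ht => ?_, ?_⟩
  · rcases p₁.trans_apply_of_mem_Ioo p₂ ht with ⟨s, hs, e⟩ | ⟨s, hs, e⟩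
    · rw [e]
      exact hb _ (mul_ne_zero hs hτ0)
    · rw [e]
      refine hS _ (mul_pos (sub_pos.2 ?_) hX)
      exact lt_of_le_of_ne s.2.2 fun h => hs (Subtype.ext h)
  · rw [Path.trans_range]
    refine union_subset ?_ ?_
    · rintro _ ⟨s, rfl⟩
      change b (s * τ) ∈ _
      rcases (unitInterval.mul_le_right (x := s) (y := τ)).lt_or_eq with h | h
      · exact Or.inl ⟨⟨_, rfl⟩, hmin' _ h⟩
      · rw [h, ← hXY]
        exact Or.inr ⟨X, ⟨hX.le, le_rfl⟩, rfl⟩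
    · rintro _ ⟨s, rfl⟩
      refine Or.inr ⟨(1 - s) * X, ⟨mul_nonneg (sub_nonneg.2 s.2.2) hX.le, ?_⟩, rfl⟩
      exact mul_le_of_le_one_left hX.le (by linarith [s.2.1])

/-- The set is star-shaped about (2, 0), a point beyond the tip of the hair. -/
theorem isPreconnected_rightHalf_diff :
    IsPreconnected ({q : ℝ × ℝ | 0 < q.1} \ (Icc (0 : ℝ) 1 ×ˢ {0})) := by
  have hmem : ((2 : ℝ), (0 : ℝ)) ∈ {q : ℝ × ℝ | 0 < q.1} \ (Icc (0 : ℝ) 1 ×ˢ {0}) := by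
    refine ⟨by simp, ?_⟩
    simp
  refine (StarConvex.isPathConnected (a := ((2 : ℝ), (0 : ℝ))) ?_ hmem).isConnected.isPreconnected
  rintro ⟨u, v⟩ ⟨h1, h2⟩ a b ha hb hab
  simp only [mem_ofPred_eq] at h1
  simp only [mem_prod, mem_Icc, mem_singleton_iff, not_and, and_imp] at h2
  refine ⟨?_, ?_⟩
  · change 0 < a * 2 + b * u
    rcases ha.lt_or_eq with h | h
    · positivity
    · have : b = 1 := by linarith
      rw [← h, this]
      linarith
  · rintro ⟨⟨-, h3⟩, h4⟩
    change a * 2 + b * u ≤ 1 at h3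
    change a * 0 + b * v = 0 at h4
    have hb0 : b ≠ 0 := by
      rintro rfl
      linarith
    have hv : v = 0 := by
      rw [mul_zero, zero_add] at h4
      exact (mul_eq_zero.1 h4).resolve_left hb0
    have hu : 1 < u := by
      by_contra hcon
      exact h2 h1.le (not_lt.1 hcon) hv
    have : b * 1 ≤ b * u := by gcongr
    have h5 : a * 2 + b * 1 ≤ 1 := by linarith
    have h6 : a = 0 := by linarith
    have h7 : b = 1 := by linarith
    rw [h6, h7] at h3
    linarith

/-- Removing a hair from a connected open set does not disconnect it. -/
theorem isPreconnected_diff_hair {ψ : ℝ × ℝ → ℂ} (hψ : IsOpenEmbedding ψ) {S : Set ℂ}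
    (hS : IsOpen S) (hSc : IsPreconnected S) (hψS : ∀ q, ψ q ∈ S ↔ 0 < q.1) :
    IsPreconnected (S \ ψ '' (Icc (0 : ℝ) 1 ×ˢ {0})) := by
  classical
  set H := ψ '' (Icc (0 : ℝ) 1 ×ˢ {0}) with hH
  have hHcl : IsClosed H :=
    ((isCompact_Icc.prod isCompact_singleton).image hψ.continuous).isClosed
  refine isPreconnected_of_forall_constant fun f hf => ?_
  have hc : ∀ q ∈ {q : ℝ × ℝ | 0 < q.1} \ (Icc (0 : ℝ) 1 ×ˢ {0}), f (ψ q) = f (ψ (2, 0)) := by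
    intro q hq
    refine isPreconnected_rightHalf_diff.constant_of_mapsTo (f := f ∘ ψ) (x := q) (y := (2, 0)) .univ
      (hf.comp hψ.continuous.continuousOn fun a ha => ⟨(hψS a).2 ha.1, ?_⟩)
      (fun _ _ => mem_univ _) hq (by simp)
    rintro ⟨a', ha', e⟩
    exact ha.2 (hψ.injective e ▸ ha')
  -- In the chart `f` has a single value off the hair; assigning it to the hair extends `f`
  -- continuously to the connected set `S`.
  let g : ℂ → Bool := fun z => if z ∈ H then f (ψ (2, 0)) else f z
  have hg : ContinuousOn g S := by
    intro z hz
    refine ContinuousAt.continuousWithinAt ?_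
    by_cases hzH : z ∈ H
    · have hz' := hzH
      obtain ⟨q, -, rfl⟩ := hz'
      have : g =ᶠ[𝓝 (ψ q)] fun _ => f (ψ (2, 0)) := by
        filter_upwards [(hψ.isOpenMap _ (isOpen_lt continuous_const continuous_fst)).mem_nhds
          ⟨q, (hψS q).1 hz, rfl⟩]
        rintro _ ⟨a, ha, rfl⟩
        by_cases haH : ψ a ∈ H
        · simp [g, haH]
        · simp only [g, haH, if_false]
          exact hc a ⟨ha, fun h => haH ⟨a, h, rfl⟩⟩
      exact this.continuousAt
    · have : g =ᶠ[𝓝 z] f := by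
        filter_upwards [hHcl.isOpen_compl.mem_nhds hzH] with w hw
        simp only [g, if_neg hw]
      exact ((hf z ⟨hz, hzH⟩).continuousAt
        ((hS.inter hHcl.isOpen_compl).mem_nhds ⟨hz, hzH⟩)).congr this.symm
  intro x hx y hy
  have := hSc.constant_of_mapsTo .univ hg (fun _ _ => mem_univ _) hx.1 hy.1
  simpa [g, hx.2, hy.2] using this

/-- If three lines do not separate each other, two of them can be joined to the third one by
disjoint paths, off the three lines. -/
theorem exists_disjoint_paths {C₀ P₀ N₀ C₁ P₁ N₁ C₂ P₂ N₂ : Set ℂ} (h₀ : FlatSides C₀ P₀ N₀)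
    (h₁ : FlatSides C₁ P₁ N₁) (h₂ : FlatSides C₂ P₂ N₂) (h01 : P₁ ∪ C₁ ⊆ N₀)
    (h02 : P₂ ∪ C₂ ⊆ N₀) (h12 : P₂ ∪ C₂ ⊆ N₁) :
    ∃ x₁ ∈ C₁, ∃ x₂ ∈ C₂, ∃ y₁ ∈ C₀, ∃ y₂ ∈ C₀, ∃ (α₁ : Path x₁ y₁) (α₂ : Path x₂ y₂),
      Disjoint (range α₁) (range α₂) ∧
        ∀ t ∈ Ioo (0 : unitInterval) 1, α₁ t ∈ N₀ ∩ N₁ ∩ N₂ ∧ α₂ t ∈ N₀ ∩ N₁ ∩ N₂ := by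
  have h10 : P₀ ∪ C₀ ⊆ N₁ := by
    rw [← h₀.compl_right, compl_subset_comm, h₁.compl_right]
    exact h01
  have h20 : P₀ ∪ C₀ ⊆ N₂ := by
    rw [← h₀.compl_right, compl_subset_comm, h₂.compl_right]
    exact h02
  have h21 : P₁ ∪ C₁ ⊆ N₂ := by
    rw [← h₁.compl_right, compl_subset_comm, h₂.compl_right]
    exact h12
  set S := N₀ ∩ N₁ ∩ N₂ with hSdef
  have hSo : IsOpen S := (h₀.isOpen_right.inter h₁.isOpen_right).inter h₂.isOpen_right
  have hSc : IsPreconnected S :=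
    h₂.isPreconnected_inter_right (h₀.isOpen_right.inter h₁.isOpen_right)
      (h₁.isPreconnected_inter_right h₀.isOpen_right h₀.isPreconnected_right h01)
      (subset_inter h02 h12)
  have hS0 : Disjoint S C₀ := h₀.disjoint_right_line.mono_left fun z hz => hz.1.1
  have hS1 : Disjoint S C₁ := h₁.disjoint_right_line.mono_left fun z hz => hz.1.2
  have hS2 : Disjoint S C₂ := h₂.disjoint_right_line.mono_left fun z hz => hz.2
  obtain ⟨y₀, hy₀⟩ := h₀.isConnected.nonempty
  obtain ⟨x₁, hx₁⟩ := h₁.isConnected.nonempty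
  obtain ⟨x₂, hx₂⟩ := h₂.isConnected.nonempty
  obtain ⟨ψ₀, hψ₀, hψ₀0, hsub₀, hs₀⟩ := h₀.exists_chart y₀ hy₀ (N₁ ∩ N₂)
    ((h₁.isOpen_right.inter h₂.isOpen_right).mem_nhds ⟨h10 (Or.inr hy₀), h20 (Or.inr hy₀)⟩)
  obtain ⟨ψ₁, hψ₁, hψ₁0, hsub₁, hs₁⟩ := h₁.exists_chart x₁ hx₁ (N₀ ∩ N₂)
    ((h₀.isOpen_right.inter h₂.isOpen_right).mem_nhds ⟨h01 (Or.inr hx₁), h21 (Or.inr hx₁)⟩)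
  have hψ₀S : ∀ q : ℝ × ℝ, 0 < q.1 → ψ₀ q ∈ S := fun q hq =>
    ⟨⟨(hs₀ q).2.2 hq, (hsub₀ ⟨q, rfl⟩).1⟩, (hsub₀ ⟨q, rfl⟩).2⟩
  have hψ₁S : ∀ q, ψ₁ q ∈ S ↔ 0 < q.1 := by
    intro q
    constructor
    · intro hq
      by_contra hcon
      rcases (not_lt.1 hcon).lt_or_eq with h | h
      · exact disjoint_left.1 h₁.disjoint ((hs₁ q).1 h) hq.1.2
      · exact disjoint_left.1 hS1 hq ((hs₁ q).2.1 h)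
    · intro hq
      exact ⟨⟨(hsub₁ ⟨q, rfl⟩).1, (hs₁ q).2.2 hq⟩, (hsub₁ ⟨q, rfl⟩).2⟩
  -- The first path is a straight hair at `x₁` whose tip is moved into the chart at `y₀` by a
  -- homeomorphism supported in `S`. Unlike an arbitrary path, its image does not disconnect `S`.
  obtain ⟨h, hh, hid⟩ := exists_homeomorph_of_isPreconnected hSo hSc
    ((hψ₁S (1, 0)).2 (by simp)) (hψ₀S (1 / 2, 0) (by norm_num))
  have hhS : h '' S = S := by
    have hc : h '' Sᶜ = Sᶜ := by
      ext z
      constructor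
      · rintro ⟨w, hw, rfl⟩
        rwa [hid w hw]
      · intro hz
        exact ⟨z, hz, hid z hz⟩
    rw [image_compl_eq h.bijective] at hc
    exact compl_injective hc
  have hx₁S : x₁ ∉ S := fun hx => disjoint_left.1 hS1 hx hx₁
  have hx₂S : x₂ ∉ S := fun hx => disjoint_left.1 hS2 hx hx₂
  let b₁ : Path x₁ (ψ₀ (1 / 2, 0)) :=
    ⟨⟨fun t => h (ψ₁ (t, 0)), h.continuous.comp (hψ₁.continuous.comp (by fun_prop))⟩,
      by
        change h (ψ₁ (((0 : unitInterval) : ℝ), 0)) = x₁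
        rw [Icc.coe_zero, ← Prod.zero_eq_mk, hψ₁0, hid _ hx₁S],
      by simpa using hh⟩
  have hb₁ : ∀ t, t ≠ 0 → b₁ t ∈ S := by
    intro t ht
    rw [← hhS]
    exact mem_image_of_mem h ((hψ₁S _).2 (unitInterval.pos_iff_ne_zero.2 ht))
  have hb₁r : range b₁ = h '' (ψ₁ '' (Icc (0 : ℝ) 1 ×ˢ {0})) := by
    ext z
    constructor
    · rintro ⟨t, rfl⟩
      exact ⟨_, ⟨(t, 0), ⟨t.2, rfl⟩, rfl⟩, rfl⟩
    · rintro ⟨_, ⟨⟨a, b⟩, ⟨ha, rfl⟩, rfl⟩, rfl⟩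
      exact ⟨⟨a, ha⟩, rfl⟩
  have hb₁n : ∀ z ∉ S, z ≠ x₁ → z ∉ range b₁ := by
    rintro z hz hzx ⟨t, rfl⟩
    by_cases ht : t = 0
    · exact hzx (by rw [ht, b₁.source])
    · exact hz (hb₁ t ht)
  have hb₁cl : IsClosed (range b₁) := (isCompact_range b₁.continuous).isClosed
  have hne01 : ∀ z ∈ C₀, z ≠ x₁ := by
    rintro z hz rfl
    exact disjoint_left.1 h₀.disjoint_right_line (h01 (Or.inr hx₁)) hz
  have hne21 : x₂ ≠ x₁ := by
    rintro rfl
    exact disjoint_left.1 h₁.disjoint_right_line (h12 (Or.inr hx₂)) hx₁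
  have hx₂b : x₂ ∉ range b₁ := hb₁n _ hx₂S hne21
  obtain ⟨ψ₂, hψ₂, hψ₂0, hsub₂, hs₂⟩ := h₂.exists_chart x₂ hx₂ (N₀ ∩ N₁ ∩ (range b₁)ᶜ)
    (((h₀.isOpen_right.inter h₁.isOpen_right).inter hb₁cl.isOpen_compl).mem_nhds
      ⟨⟨h02 (Or.inr hx₂), h12 (Or.inr hx₂)⟩, hx₂b⟩)
  have hψ₂S : ∀ q : ℝ × ℝ, 0 < q.1 → ψ₂ q ∈ S \ range b₁ := fun q hq =>
    ⟨⟨(hsub₂ ⟨q, rfl⟩).1, (hs₂ q).2.2 hq⟩, (hsub₂ ⟨q, rfl⟩).2⟩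
  obtain ⟨ε, hε, hε1, hεb⟩ : ∃ ε : ℝ, 0 < ε ∧ ε ≤ 1 ∧ ψ₀ (ε, 0) ∉ range b₁ := by
    have hcont : ContinuousAt (fun ε : ℝ => ψ₀ (ε, 0)) 0 :=
      (hψ₀.continuous.comp (by fun_prop : Continuous fun ε : ℝ => (ε, (0 : ℝ)))).continuousAt
    have h1 : ψ₀ ((0 : ℝ), 0) ∉ range b₁ := by
      rw [← Prod.zero_eq_mk, hψ₀0]
      exact hb₁n _ (fun hy => disjoint_left.1 hS0 hy hy₀) (hne01 _ hy₀)
    have h2 := hcont.eventually (hb₁cl.isOpen_compl.mem_nhds h1)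
    obtain ⟨δ, hδ, hball⟩ := Metric.eventually_nhds_iff.1 h2
    refine ⟨min (δ / 2) 1, by positivity, min_le_right _ _, hball ?_⟩
    rw [Real.dist_eq, sub_zero, abs_of_pos (by positivity)]
    exact (min_le_left _ _).trans_lt (by linarith)
  -- This set is the image under `h` of `S` minus the straight hair; the second path is drawn in it.
  have hdiff : IsPathConnected (S \ range b₁) := by
    rw [← (hSo.sdiff hb₁cl).isConnected_iff_isPathConnected]
    refine ⟨⟨_, hψ₀S _ hε, hεb⟩, ?_⟩
    rw [hb₁r, ← hhS, ← image_sdiff h.injective]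
    exact (isPreconnected_diff_hair hψ₁ hSo hSc hψ₁S).image _ h.continuous.continuousOn
  obtain ⟨c, hc⟩ := hdiff.joinedIn _ (hψ₂S (1, 0) (by simp)) _ ⟨hψ₀S (ε, 0) hε, hεb⟩
  let e₂ : Path x₂ (ψ₂ (1, 0)) :=
    ⟨⟨fun t => ψ₂ (t, 0), hψ₂.continuous.comp (by fun_prop)⟩,
      by
        change ψ₂ (((0 : unitInterval) : ℝ), 0) = x₂
        rw [Icc.coe_zero, ← Prod.zero_eq_mk, hψ₂0],
      by simp⟩
  have hb₂ : ∀ t, t ≠ 0 → e₂.trans c t ∈ S \ range b₁ := by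
    intro t ht
    by_cases ht1 : t = 1
    · rw [ht1, Path.target]
      exact ⟨hψ₀S _ hε, hεb⟩
    · rcases e₂.trans_apply_of_mem_Ioo c
        ⟨unitInterval.pos_iff_ne_zero.2 ht, unitInterval.lt_one_iff_ne_one.2 ht1⟩ with
        ⟨s, hs, e⟩ | ⟨s, hs, e⟩
      · rw [e]
        exact hψ₂S _ (unitInterval.pos_iff_ne_zero.2 hs)
      · rw [e]
        exact hc s
  have hdisj : ∀ z ∈ range b₁, z ∉ range (e₂.trans c) := by
    rintro z hz ⟨t, rfl⟩
    by_cases ht : t = 0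
    · rw [ht, Path.source] at hz
      exact hx₂b hz
    · exact (hb₂ t ht).2 hz
  obtain ⟨X₁, Y₁, hX₁, hXY₁, hmem₁, α₁, hα₁, hr₁⟩ := exists_path_drop hψ₀ hψ₀S
    (fun q => (hs₀ q).2.1) hS0 b₁ hb₁ hx₁S (fun hx => hne01 _ hx rfl) rfl
    ⟨(1 / 2, 0), by norm_num, rfl⟩
  obtain ⟨X₂, Y₂, hX₂, hXY₂, hmem₂, α₂, hα₂, hr₂⟩ := exists_path_drop hψ₀ hψ₀S
    (fun q => (hs₀ q).2.1) hS0 (e₂.trans c) (fun t ht => (hb₂ t ht).1) hx₂S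
    (fun hx => disjoint_left.1 h₀.disjoint_right_line (h02 (Or.inr hx₂)) hx) rfl
    ⟨(ε, 0), ⟨hε.le, by simp only; nlinarith⟩, rfl⟩
  -- Equal heights would give the same point of the arc, common to the two disjoint paths.
  have hY : Y₁ ≠ Y₂ := by
    rintro rfl
    have : X₁ = X₂ := by
      have h1 : X₁ ^ 2 = X₂ ^ 2 := by linarith
      exact (pow_left_inj₀ hX₁.le hX₂.le two_ne_zero).1 h1
    subst this
    exact hdisj _ hmem₁ hmem₂
  have hseg : ∀ X Y : ℝ, X ^ 2 + Y ^ 2 = 1 → (fun X' => ψ₀ (X', Y)) '' Icc 0 X ⊆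
      ψ₀ '' {q | 0 ≤ q.1 ∧ q.1 ^ 2 + q.2 ^ 2 ≤ 1} := by
    rintro X Y hXY _ ⟨X', hX', rfl⟩
    refine ⟨(X', Y), ⟨hX'.1, ?_⟩, rfl⟩
    have := pow_le_pow_left₀ hX'.1 hX'.2 2
    simp only
    linarith
  refine ⟨x₁, hx₁, x₂, hx₂, _, (hs₀ (0, Y₁)).2.1 rfl, _, (hs₀ (0, Y₂)).2.1 rfl, α₁, α₂, ?_,
    fun t ht => ⟨hα₁ t ht, hα₂ t ht⟩⟩
  rw [disjoint_left]
  intro z hz₁ hz₂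
  rcases hr₁ hz₁ with h1 | h1 <;> rcases hr₂ hz₂ with h2 | h2
  · exact hdisj z h1.1 h2.1
  · exact h1.2 (hseg _ _ hXY₂ h2)
  · exact h2.2 (hseg _ _ hXY₁ h1)
  · obtain ⟨a, -, ha⟩ := h1
    obtain ⟨b, -, hb⟩ := h2
    exact hY (congrArg Prod.snd (hψ₀.injective (ha.trans hb.symm)))

/-! ### The crossing theorem -/

theorem FlatSides.isPathConnected_right {C P N : Set ℂ} (h : FlatSides C P N)
    (hC : IsPathConnected C) : IsPathConnected (N ∪ C) := by
  obtain ⟨x, hx⟩ := h.isConnected.nonempty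
  obtain ⟨ψ, hψ, rfl, -, hs⟩ := h.exists_chart x hx univ univ_mem
  have h1 : IsPathConnected N :=
    h.isOpen_right.isConnected_iff_isPathConnected.1 ⟨h.nonempty_right, h.isPreconnected_right⟩
  have h2 : IsPathConnected (ψ '' {q : ℝ × ℝ | 0 ≤ q.1}) :=
    ((convex_halfSpace_ge ((LinearMap.fst ℝ ℝ ℝ).isLinear) 0).isPathConnected
      ⟨0, le_refl (0 : ℝ)⟩).image hψ.continuous
  have h3 := (h1.union h2 ⟨ψ (1, 0), (hs _).2.2 (by simp), (1, 0), by simp, rfl⟩).union hC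
    ⟨ψ 0, Or.inr ⟨0, by simp, rfl⟩, hx⟩
  convert h3 using 1
  refine subset_antisymm (by tauto_set) (union_subset (union_subset (by tauto_set) ?_) (by tauto_set))
  rintro _ ⟨q, hq, rfl⟩
  rcases (show 0 ≤ q.1 from hq).lt_or_eq with h0 | h0
  · exact Or.inl ((hs q).2.2 h0)
  · exact Or.inr ((hs q).2.1 h0.symm)

/-- Two lines on the same side of a third one, joined to it by disjoint paths: the logarithm along
the ray that follows the path `a` is the same as the one along the end of the third line that is
not separated by `a` from the first line. -/
theorem exists_path_rayLog {C₀ P₀ N₀ C₁ P₁ N₁ C₂ P₂ N₂ : Set ℂ} (h₀ : FlatSides C₀ P₀ N₀)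
    (h₁ : FlatSides C₁ P₁ N₁) (h₂ : FlatSides C₂ P₂ N₂) (h01 : P₁ ∪ C₁ ⊆ N₀)
    (h02 : P₂ ∪ C₂ ⊆ N₀) (h12 : P₂ ∪ C₂ ⊆ N₁) (hC₂ : IsPathConnected C₂) {y : ℂ}
    (hy : y ∈ P₂ ∪ C₂) :
    ∃ y₁ ∈ C₀, ∃ y₂ ∈ C₀, ∃ a : Path y₂ y, range a ⊆ N₁ ∧ range a ⊆ N₀ ∪ C₀ ∧
      (∃ x₁ ∈ C₁, ∃ x₂ ∈ C₂, ∃ (α₁ : Path x₁ y₁) (α₂ : Path x₂ y₂),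
        Disjoint (range α₁) (range α₂) ∧ ∀ t ∈ Ioo (0 : unitInterval) 1,
          α₁ t ∉ C₀ ∪ C₁ ∪ C₂ ∧ α₂ t ∉ C₀ ∪ C₁ ∪ C₂) ∧
      ∀ (J S E : Set ℂ) (r₀ r : ℝ → ℂ) (p q ζ₀ δ ζ : ℂ), J ⊆ C₀ → y₁ ∈ J → S ⊆ C₀ →
        Disjoint S J → IsRayIn r₀ S y₂ → IsRayIn r E y → E ⊆ P₂ ∪ C₂ → p ∈ P₁ ∪ C₁ ∪ P₀ →
        q ∈ P₁ ∪ C₁ ∪ P₀ → PathLog a p q δ → RayLog r p q ζ → RayLog r₀ p q ζ₀ → δ + ζ = ζ₀ := by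
  obtain ⟨x₁, hx₁, x₂, hx₂, y₁, hy₁, y₂, hy₂, α₁, α₂, hd, hα⟩ :=
    exists_disjoint_paths h₀ h₁ h₂ h01 h02 h12
  have h10 : P₀ ∪ C₀ ⊆ N₁ := by
    rw [← h₀.compl_right, compl_subset_comm, h₁.compl_right]
    exact h01
  have h20 : P₀ ∪ C₀ ⊆ N₂ := by
    rw [← h₀.compl_right, compl_subset_comm, h₂.compl_right]
    exact h02
  have h21 : P₁ ∪ C₁ ⊆ N₂ := by
    rw [← h₁.compl_right, compl_subset_comm, h₂.compl_right]
    exact h12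
  have hrange : ∀ {x y : ℂ} (α : Path x y) (T : Set ℂ), x ∈ T → y ∈ T →
      (∀ t ∈ Ioo (0 : unitInterval) 1, α t ∈ T) → range α ⊆ T := by
    rintro x y α T hx hy hT _ ⟨t, rfl⟩
    rcases eq_or_ne t 0 with rfl | h0
    · rwa [α.source]
    rcases eq_or_ne t 1 with rfl | h1
    · rwa [α.target]
    exact hT t ⟨unitInterval.pos_iff_ne_zero.2 h0, unitInterval.lt_one_iff_ne_one.2 h1⟩
  have hα₂N₁ : range α₂ ⊆ N₁ := hrange α₂ _ (h12 (Or.inr hx₂)) (h10 (Or.inr hy₂))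
    fun t ht => (hα t ht).2.1.2
  have hα₁N₂ : range α₁ ⊆ N₂ := hrange α₁ _ (h21 (Or.inr hx₁)) (h20 (Or.inr hy₁))
    fun t ht => (hα t ht).1.2
  have hα₂N₀ : range α₂ ⊆ N₀ ∪ {y₂} := hrange α₂ _ (Or.inl (h02 (Or.inr hx₂))) (Or.inr rfl)
    fun t ht => Or.inl (hα t ht).2.1.1
  have hα₁N₀ : range α₁ ⊆ N₀ ∪ {y₁} := hrange α₁ _ (Or.inl (h01 (Or.inr hx₁))) (Or.inr rfl)
    fun t ht => Or.inl (hα t ht).1.1.1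
  obtain ⟨e, he⟩ := (h₂.symm.isPathConnected_right hC₂).joinedIn x₂ (Or.inr hx₂) y hy
  have he' : range e ⊆ P₂ ∪ C₂ := range_subset_iff.2 he
  have ha : range (α₂.symm.trans e) = range α₂ ∪ range e := by
    rw [Path.trans_range, Path.symm_range]
  refine ⟨y₁, hy₁, y₂, hy₂, α₂.symm.trans e, ?_, ?_, ⟨x₁, hx₁, x₂, hx₂, α₁, α₂, hd, ?_⟩, ?_⟩
  · rw [ha]
    exact union_subset hα₂N₁ (he'.trans h12)
  · rw [ha]
    exact union_subset (hα₂N₀.trans (union_subset_union_right _ (singleton_subset_iff.2 hy₂)))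
      ((he'.trans h02).trans subset_union_left)
  · have key : ∀ z ∈ N₀ ∩ N₁ ∩ N₂, z ∉ C₀ ∪ C₁ ∪ C₂ := by
      rintro z ⟨⟨hz0, hz1⟩, hz2⟩ ((hz | hz) | hz)
      · exact disjoint_left.1 h₀.disjoint_right_line hz0 hz
      · exact disjoint_left.1 h₁.disjoint_right_line hz1 hz
      · exact disjoint_left.1 h₂.disjoint_right_line hz2 hz
    exact fun t ht => ⟨key _ (hα t ht).1, key _ (hα t ht).2⟩
  · intro J S E r₀ r p q ζ₀ δ ζ hJ hy₁J hS hSJ hr₀ hr hE hp hq hδ hζ hζ₀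
    have hqa : q ∉ range (α₂.symm.trans e) := by
      rw [ha]
      rintro (h | h)
      · rcases hq with hq | hq
        · exact (h₁.compl_right.symm ▸ hq : q ∈ N₁ᶜ) (hα₂N₁ h)
        · rcases hα₂N₀ h with h | h
          · exact disjoint_left.1 h₀.disjoint hq h
          · rw [mem_singleton_iff.1 h] at hq
            exact disjoint_left.1 h₀.symm.disjoint_right_line hq hy₂
      · rcases hq with hq | hq
        · exact (h₁.compl_right.symm ▸ hq : q ∈ N₁ᶜ) (h12 (he' h))
        · exact disjoint_left.1 h₀.disjoint hq (h02 (he' h))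
    obtain ⟨r', hr', hlog⟩ := hr.prepend (α₂.symm.trans e)
    have hζ' := hlog p q δ ζ (fun h => hqa ⟨1, (Path.target _).trans h⟩) hδ hζ
    have hy₂S : y₂ ∈ S := hr₀.apply_zero ▸ hr₀.range_subset ⟨0, rfl⟩
    -- This set contains `p` and `q` and avoids both rays: it leaves the first closed half plane
    -- along `α₁` and crosses `C₀` only within `J`, away from `S`.
    have hK : IsPreconnected ((P₁ ∪ C₁) ∪ range α₁ ∪ (P₀ ∪ J)) := by
      have k₁ : x₁ ∈ range α₁ := ⟨0, α₁.source⟩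
      have k₂ : y₁ ∈ range α₁ := ⟨1, α₁.target⟩
      exact ((h₁.symm.isPreconnected_right_union subset_rfl).union x₁ (Or.inr hx₁) k₁
        (isPreconnected_range α₁.continuous)).union y₁ (Or.inr k₂) (Or.inr hy₁J)
        (h₀.symm.isPreconnected_right_union hJ)
    refine RayLog.eq_of_isPreconnected hr' hr₀ hK ?_ ?_ ?_ ?_ hζ' hζ₀
    · rw [disjoint_left, ha]
      have hz2 : ∀ z ∈ P₂ ∪ C₂, z ∉ (P₁ ∪ C₁) ∪ range α₁ ∪ (P₀ ∪ J) := by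
        rintro z hz ((h | h) | h)
        · exact (h₁.compl_right.symm ▸ h : z ∈ N₁ᶜ) (h12 hz)
        · exact (h₂.compl_right.symm ▸ hz : z ∈ N₂ᶜ) (hα₁N₂ h)
        · exact (h₀.compl_right.symm ▸ (union_subset_union_right _ hJ h) : z ∈ N₀ᶜ) (h02 hz)
      rintro z ((hz | hz) | hz)
      · rintro ((h | h) | h)
        · exact (h₁.compl_right.symm ▸ h : z ∈ N₁ᶜ) (hα₂N₁ hz)
        · exact disjoint_left.1 hd h hz
        · rcases hα₂N₀ hz with hz | hz
          · exact (h₀.compl_right.symm ▸ (union_subset_union_right _ hJ h) : z ∈ N₀ᶜ) hz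
          · rw [mem_singleton_iff.1 hz] at h
            rcases h with h | h
            · exact disjoint_left.1 h₀.symm.disjoint_right_line h hy₂
            · exact disjoint_left.1 hSJ hy₂S h
      · exact hz2 z (he' hz)
      · exact hz2 z (hE hz)
    · rw [disjoint_left]
      rintro z hz ((h | h) | (h | h))
      · exact disjoint_left.1 h₀.disjoint_right_line (h01 h) (hS hz)
      · rcases hα₁N₀ h with h | h
        · exact disjoint_left.1 h₀.disjoint_right_line h (hS hz)
        · exact disjoint_left.1 hSJ hz (mem_singleton_iff.1 h ▸ hy₁J)
      · exact disjoint_left.1 h₀.symm.disjoint_right_line h (hS hz)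
      · exact disjoint_left.1 hSJ hz h
    · exact hp.imp Or.inl Or.inl
    · exact hq.imp Or.inl Or.inl

/-- Let `l₁`, `l₂` lie on the left of `φ` and `m₁`, `m₂` on its right, with `l₂` above `l₁` and
`m₁` above `m₂`. Then a connected set that joins `l₁` to `m₁` meets every connected set that joins
`l₂` to `m₂`. -/
theorem not_disjoint_of_isAboveRel {φ l₁ l₂ m₁ m₂ : ℝ → ℂ} (hφ : IsLine φ)
    (h₀ : FlatSides (range φ) (leftSide φ) (rightSide φ))
    (hside : ∀ p ∈ leftSide φ, ∀ q ∈ rightSide φ, SideIndexOne φ p q)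
    (hl₁ : FlatSides (range l₁) (leftSide l₁) (rightSide l₁))
    (hl₂ : FlatSides (range l₂) (leftSide l₂) (rightSide l₂))
    (hm₁ : FlatSides (range m₁) (leftSide m₁) (rightSide m₁))
    (hm₂ : FlatSides (range m₂) (leftSide m₂) (rightSide m₂))
    (hl₂c : Continuous l₂) (hm₂c : Continuous m₂)
    (hl₁φ : leftSide l₁ ∪ range l₁ ⊆ leftSide φ) (hl₂φ : leftSide l₂ ∪ range l₂ ⊆ leftSide φ)
    (hm₁φ : rightSide m₁ ∪ range m₁ ⊆ rightSide φ) (hm₂φ : rightSide m₂ ∪ range m₂ ⊆ rightSide φ)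
    (hll : leftSide l₂ ∪ range l₂ ⊆ rightSide l₁) (hmm : rightSide m₂ ∪ range m₂ ⊆ leftSide m₁)
    (hA : IsAboveRel φ l₁ l₂) (hB : IsAboveRel φ m₂ m₁)
    {K₁ K₂ A B E E' : Set ℂ} {p q y y' : ℂ} {r r' : ℝ → ℂ}
    (hK₁ : IsPreconnected K₁) (hK₁c : IsClosed K₁) (hK₂ : IsPreconnected K₂)
    (hAc : IsPreconnected A) (hBc : IsPreconnected B) (hAu : ¬ Bornology.IsBounded A)
    (hBu : ¬ Bornology.IsBounded B) (hAK : A ⊆ K₁) (hBK : B ⊆ K₁)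
    (hAl : A ⊆ leftSide l₁ ∪ range l₁) (hBm : B ⊆ rightSide m₁ ∪ range m₁)
    (hp : p ∈ A) (hq : q ∈ B) (hEK : E ⊆ K₂) (hEK' : E' ⊆ K₂)
    (hEl : E ⊆ leftSide l₂ ∪ range l₂) (hEm : E' ⊆ rightSide m₂ ∪ range m₂)
    (hr : IsRayIn r E y) (hr' : IsRayIn r' E' y') : ¬ Disjoint K₁ K₂ := by
  intro hdisj
  have hyE : y ∈ E := hr.apply_zero ▸ hr.range_subset ⟨0, rfl⟩
  have hyE' : y' ∈ E' := hr'.apply_zero ▸ hr'.range_subset ⟨0, rfl⟩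
  obtain ⟨_, ⟨u₁, rfl⟩, _, ⟨u₂, rfl⟩, a, haN, ha0, ⟨x₁, hx₁, x₂, hx₂, α₁, α₂, hα, hα'⟩, haR⟩ :=
    exists_path_rayLog h₀.symm hl₁ hl₂ hl₁φ hl₂φ hll (isPathConnected_range hl₂c) (hEl hyE)
  obtain ⟨_, ⟨v₁, rfl⟩, _, ⟨v₂, rfl⟩, b, hbN, hb0, ⟨w₁, hw₁, w₂, hw₂, β₁, β₂, hβ, hβ'⟩, hbR⟩ :=
    exists_path_rayLog h₀ hm₁.symm hm₂.symm hm₁φ hm₂φ hmm (isPathConnected_range hm₂c) (hEm hyE')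
  have hu : u₁ < u₂ := hA.2.2 x₁ x₂ u₁ u₂ α₁ α₂ hx₁ hx₂ hα hα'
  have hv : v₂ < v₁ := by
    refine hB.2.2 w₂ w₁ v₂ v₁ β₂ β₁ hw₂ hw₁ hβ.symm fun t ht => ?_
    rw [union_right_comm]
    exact (hβ' t ht).symm
  have hpl : p ∈ leftSide φ := hl₁φ (hAl hp)
  have hqr : q ∈ rightSide φ := hm₁φ (hBm hq)
  obtain ⟨-, -, θ, hθc, hθ, hθ0, hθ1⟩ := hside p hpl q hqr
  have hlog : LogRatio φ p q θ := ⟨hθc, hθ⟩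
  have hdφ : Disjoint (leftSide φ) (rightSide φ) := h₀.disjoint
  have hdφl : Disjoint (leftSide φ) (range φ) := h₀.symm.disjoint_right_line
  have hdφr : Disjoint (rightSide φ) (range φ) := h₀.disjoint_right_line
  -- the paths `a`, `b` and the arc of `φ` avoid `A` and `B`
  have haA : Disjoint (range a) A := disjoint_left.2 fun z hz hzA =>
    (hl₁.compl_right.symm ▸ hAl hzA : z ∈ (rightSide l₁)ᶜ) (haN hz)
  have haB : Disjoint (range a) B := disjoint_left.2 fun z hz hzB =>
    (ha0 hz).elim (fun h => disjoint_left.1 hdφ h (hm₁φ (hBm hzB)))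
      fun h => disjoint_left.1 hdφr (hm₁φ (hBm hzB)) h
  have hbB : Disjoint (range b) B := disjoint_left.2 fun z hz hzB =>
    (hm₁.symm.compl_right.symm ▸ hBm hzB : z ∈ (leftSide m₁)ᶜ) (hbN hz)
  have hbA : Disjoint (range b) A := disjoint_left.2 fun z hz hzA =>
    (hb0 hz).elim (fun h => disjoint_left.1 hdφ (hl₁φ (hAl hzA)) h)
      fun h => disjoint_left.1 hdφl (hl₁φ (hAl hzA)) h
  have hφA : Disjoint (range φ) A := (hdφl.mono_left (hAl.trans hl₁φ)).symm
  have hφB : Disjoint (range φ) B := (hdφr.mono_left (hBm.trans hm₁φ)).symm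
  obtain ⟨δa, hδa⟩ := PathLog.exists_of_notMem a (disjoint_right.1 haA hp) (disjoint_right.1 haB hq)
  obtain ⟨δb, hδb⟩ := PathLog.exists_of_notMem b (disjoint_right.1 hbA hp) (disjoint_right.1 hbB hq)
  have hEd : Disjoint E K₁ := (hdisj.mono_right hEK).symm
  have hEd' : Disjoint E' K₁ := (hdisj.mono_right hEK').symm
  obtain ⟨ζ, hζ⟩ := hr.exists_rayLog (disjoint_right.1 hEd (hAK hp)) (disjoint_right.1 hEd (hBK hq))
  obtain ⟨ζ', hζ'⟩ := hr'.exists_rayLog (disjoint_right.1 hEd' (hAK hp))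
    (disjoint_right.1 hEd' (hBK hq))
  -- As `u₁ < u₂`, the upper end of `φ` from `u₂` on avoids `φ u₁`; the logarithm tends to 2πi
  -- there.
  have e1 : δa + ζ = θ u₂ - 2 * Real.pi * Complex.I := by
    refine haR (φ '' Iio u₂) (φ '' Ici u₂) E _ r p q _ _ _ (image_subset_range _ _) ⟨u₁, hu, rfl⟩
      (image_subset_range _ _) ?_ (hφ.isRayIn u₂) hr hEl (Or.inl (hAl hp)) (Or.inr hqr) hδa hζ
      (hlog.rayLog hθ1 Complex.exp_two_pi_mul_I u₂)
    rw [disjoint_image_iff hφ.injective]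
    exact (Iio_disjoint_Ici le_rfl).symm
  -- On the other side the order is reversed: as `v₂ < v₁`, the lower end of `φ` is the free one,
  -- and there `θ` tends to 0. This asymmetry produces the contradiction.
  have e2 : δb + ζ' = θ v₂ := by
    have hneg := hφ.comp_neg.isRayIn (-v₂)
    have hlneg := hlog.comp_neg.rayLog (hθ0.comp tendsto_neg_atTop_atBot) Complex.exp_zero (-v₂)
    rw [neg_neg] at hneg
    rw [neg_neg, sub_zero] at hlneg
    refine hbR (φ '' Ioi v₂) ((fun t => φ (-t)) '' Ici (-v₂)) E' _ r' p q _ _ _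
      (image_subset_range _ _) ⟨v₁, hv, rfl⟩ ?_ ?_ hneg hr' hEm (Or.inr hpl) (Or.inl (hBm hq)) hδb hζ'
      hlneg
    · rintro _ ⟨t, -, rfl⟩
      exact ⟨_, rfl⟩
    · rw [disjoint_left]
      rintro _ ⟨t, ht, rfl⟩ ⟨s, hs, e⟩
      have := hφ.injective e
      simp only [mem_Ici, mem_Ioi] at ht hs
      linarith
  -- a path in the complement of `K₁`
  have hcomp : IsPathConnected (connectedComponentIn K₁ᶜ y) :=
    (hK₁c.isOpen_compl.connectedComponentIn).isConnected_iff_isPathConnected.1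
      (isConnected_connectedComponentIn_iff.2 (disjoint_right.1 hdisj (hEK hyE)))
  have hK₂sub : K₂ ⊆ connectedComponentIn K₁ᶜ y :=
    hK₂.subset_connectedComponentIn (hEK hyE) (disjoint_left.1 hdisj.symm)
  obtain ⟨c, hc⟩ := hcomp.joinedIn y (hK₂sub (hEK hyE)) y' (hK₂sub (hEK' hyE'))
  have hcK : Disjoint (range c) K₁ := by
    rw [disjoint_left]
    rintro _ ⟨t, rfl⟩
    exact connectedComponentIn_subset _ _ (hc t)
  obtain ⟨δc, hδc⟩ := PathLog.exists_of_notMem c (disjoint_right.1 hcK (hAK hp))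
    (disjoint_right.1 hcK (hBK hq))
  have hyq' : y' ≠ q := fun h => disjoint_right.1 hEd' (hBK hq) (h ▸ hyE')
  obtain ⟨s, hs, hslog⟩ := hr'.prepend c
  -- The set `K₁` connects `p` to `q` off both `r` and the ray formed by `c` and `r'`.
  have e3 : ζ = δc + ζ' := RayLog.eq_of_isPreconnected hr hs hK₁ hEd
    (disjoint_union_left.2 ⟨hcK, hEd'⟩) (hAK hp) (hBK hq) hζ (hslog p q δc ζ' hyq' hδc hζ')
  obtain ⟨g, hgr, hglog⟩ := exists_path_arc hφ.continuous u₂ v₂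
  have hφq : ∀ t, φ t ≠ q := fun t h => disjoint_left.1 hdφr hqr ⟨t, h⟩
  have hc' : PathLog ((a.symm.trans g).trans b) p q (-δa + (θ u₂ - θ v₂) + δb) :=
    PathLog.trans (hφq _) (PathLog.trans (hφq _) hδa.reverse (hglog p q θ hlog)) hδb
  have hrange : range ((a.symm.trans g).trans b) = range a ∪ range g ∪ range b := by
    rw [Path.trans_range, Path.trans_range, Path.symm_range]
  -- The path `c` and the detour through `φ` both avoid `A` and `B`, which connect `p` and `q` to
  -- infinity.
  have e4 : δc = -δa + (θ u₂ - θ v₂) + δb := by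
    refine PathLog.eq_of_unbounded hAc hBc hAu hBu hp hq (hcK.mono_right hAK) (hcK.mono_right hBK)
      ?_ ?_ hδc hc'
    · rw [hrange]
      exact disjoint_union_left.2 ⟨disjoint_union_left.2 ⟨haA, hφA.mono_left hgr⟩, hbA⟩
    · rw [hrange]
      exact disjoint_union_left.2 ⟨disjoint_union_left.2 ⟨haB, hφB.mono_left hgr⟩, hbB⟩
  refine Complex.two_pi_I_ne_zero ?_
  linear_combination e1 - e2 - e3 - e4

/-! ### Nested half planes and iterates -/

/-- If two lines lie on the right sides of each other, their closed left sides are disjoint. -/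
theorem FlatSides.union_subset_of_subset {C P N C' P' N' : Set ℂ} (h : FlatSides C P N)
    (h' : FlatSides C' P' N') (hC : C ⊆ N') (hC' : C' ⊆ N) : P' ∪ C' ⊆ N := by
  obtain ⟨x, hx⟩ := h'.isConnected.nonempty
  refine h.subset_right (h'.symm.isPreconnected_right_union subset_rfl) ?_ ⟨x, Or.inr hx, hC' hx⟩
  rw [disjoint_left, ← h'.compl_right]
  exact fun z hz hzC => hz (hC hzC)

/-- The closed sides of two lines are linked by `g` only if the lines themselves are. -/
theorem FlatSides.image_inter_nonempty {C P N D Q M T : Set ℂ} (h : FlatSides C P N)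
    (h' : FlatSides D Q M) (g : ℂ ≃ₜ ℂ) (hA : P ∪ C ⊆ g '' (P ∪ C)) (hPQ : P ∪ C ⊆ Q)
    (hB : MapsTo g (M ∪ D) (M ∪ D)) (hMN : M ∪ D ⊆ N) (hT : T.Nonempty) (hTN : T ⊆ N)
    (hTQ : T ⊆ Q) (hgT : T ⊆ g '' T) (hne : (g '' (P ∪ C) ∩ (M ∪ D)).Nonempty) :
    (g '' C ∩ D).Nonempty := by
  by_contra hcon
  have hCD : ∀ x ∈ C, g x ∉ D := fun x hx hD => hcon ⟨g x, ⟨x, hx, rfl⟩, hD⟩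
  have hMD : ∀ z ∈ M ∪ D, z ∉ Q := fun z hz => (h'.symm.compl_right.symm ▸ hz : z ∈ Qᶜ)
  have hpre : IsPreconnected (g ⁻¹' D) := by
    rw [← g.image_symm]
    exact h'.isConnected.isPreconnected.image _ g.symm.continuous.continuousOn
  rcases h.subset_or_subset hpre (disjoint_left.2 fun x hx hC => hCD x hC hx) with hD | hD
  -- Here `D` lies in the image of `P`, so the image of `N ∪ C` is on one side of `D`. The set `T`
  -- rules out that it has been pushed entirely beyond `D`: its points lie in `N`, and its image
  -- still covers `T`, which is before `D`.
  · have hd : Disjoint (g '' (N ∪ C)) D := by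
      rw [disjoint_left]
      rintro _ ⟨x, hx, rfl⟩ hxD
      exact (h.symm.compl_right.symm ▸ hx : x ∈ Pᶜ) (hD hxD)
    rcases h'.subset_or_subset ((h.isPreconnected_right_union subset_rfl).image g
      g.continuous.continuousOn) hd with hs | hs
    · obtain ⟨x, hx⟩ := h'.isConnected.nonempty
      exact hMD _ (hB (Or.inr hx)) (hs ⟨x, Or.inl (hMN (Or.inr hx)), rfl⟩)
    · obtain ⟨x, hx⟩ := hT
      obtain ⟨y, hy, e⟩ := hgT hx
      exact hMD x (Or.inl (e ▸ hs ⟨y, Or.inl (hTN hy), rfl⟩)) (hTQ hx)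
  -- Now the image of the closed left side is on one side of `D`: `hne` excludes `Q`, and the growth
  -- of `P ∪ C` under `g` excludes `M`.
  · have hd : Disjoint (g '' (P ∪ C)) D := by
      rw [disjoint_left]
      rintro _ ⟨x, hx, rfl⟩ hxD
      exact (h.compl_right.symm ▸ hx : x ∈ Nᶜ) (hD hxD)
    rcases h'.subset_or_subset ((h.symm.isPreconnected_right_union subset_rfl).image g
      g.continuous.continuousOn) hd with hs | hs
    · obtain ⟨x, hx, hx'⟩ := hne
      exact hMD x hx' (hs hx)
    · obtain ⟨x, hx⟩ := h.isConnected.nonempty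
      exact hMD x (Or.inl (hs (hA (Or.inr hx)))) (hPQ (Or.inr hx))

theorem exists_homeomorph_iterate (f : ℂ ≃ₜ ℂ) (n : ℕ) : ∃ g : ℂ ≃ₜ ℂ, ⇑g = f^[n] := by
  induction n with
  | zero => exact ⟨Homeomorph.refl ℂ, rfl⟩
  | succ n ih =>
    obtain ⟨g, hg⟩ := ih
    exact ⟨f.trans g, by rw [Function.iterate_succ, ← hg]; rfl⟩

theorem subset_image_iterate {f : ℂ → ℂ} {A : Set ℂ} (h : A ⊆ f '' A) (n : ℕ) : A ⊆ f^[n] '' A := by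
  induction n with
  | zero => simp
  | succ n ih =>
    rw [Function.iterate_succ, image_comp]
    exact ih.trans (image_mono h)

theorem image_iterate_mono {f : ℂ → ℂ} {A : Set ℂ} (h : A ⊆ f '' A) {m n : ℕ} (hmn : m ≤ n) :
    f^[m] '' A ⊆ f^[n] '' A := by
  obtain ⟨k, rfl⟩ := Nat.exists_eq_add_of_le hmn
  rw [Function.iterate_add, image_comp]
  exact image_mono (subset_image_iterate h k)

/-- Both images grow with the exponent, so they can be compared at the common exponent `max m n`,
where injectivity applies. -/
theorem disjoint_image_iterate {f : ℂ → ℂ} (hf : Function.Injective f) {A A' : Set ℂ}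
    (h : A ⊆ f '' A) (h' : A' ⊆ f '' A') (hd : Disjoint A A') (m n : ℕ) :
    Disjoint (f^[m] '' A) (f^[n] '' A') :=
  ((disjoint_image_iff (hf.iterate (max m n))).2 hd).mono
    (image_iterate_mono h (le_max_left m n)) (image_iterate_mono h' (le_max_right m n))

theorem preimage_iterate_mono {f : ℂ → ℂ} {B : Set ℂ} (h : MapsTo f B B) {m n : ℕ} (hmn : m ≤ n) :
    f^[m] ⁻¹' B ⊆ f^[n] ⁻¹' B := by
  obtain ⟨k, rfl⟩ := Nat.exists_eq_add_of_le' hmn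
  intro z hz
  rw [mem_preimage, Function.iterate_add_apply]
  exact h.iterate k hz

theorem disjoint_preimage_iterate {f : ℂ → ℂ} {B B' : Set ℂ} (h : MapsTo f B B)
    (h' : MapsTo f B' B') (hd : Disjoint B B') (m n : ℕ) :
    Disjoint (f^[m] ⁻¹' B) (f^[n] ⁻¹' B') :=
  (hd.preimage f^[max m n]).mono (preimage_iterate_mono h (le_max_left m n))
    (preimage_iterate_mono h' (le_max_right m n))

/-- The sets `A₁ ∪ B₁` and `A₂ ∪ B₂`, once each of them is made connected by suitable iterates, have
to meet; this happens between `A₁` and `B₂` or between `A₂` and `B₁`. -/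
theorem image_iterate_inter_or {f : ℂ ≃ₜ ℂ} {A₁ A₂ B₁ B₂ : Set ℂ}
    (hA₁ : A₁ ⊆ f '' A₁) (hA₂ : A₂ ⊆ f '' A₂) (hB₁ : MapsTo f B₁ B₁) (hB₂ : MapsTo f B₂ B₂)
    (hA : Disjoint A₁ A₂) (hB : Disjoint B₁ B₂)
    (hA₁c : IsPreconnected A₁) (hA₂c : IsPreconnected A₂) (hB₁c : IsPreconnected B₁)
    (hB₂c : IsPreconnected B₂) (hA₁cl : IsClosed A₁) (hB₁cl : IsClosed B₁)
    (hcross : ∀ K₁ K₂ : Set ℂ, IsPreconnected K₁ → IsClosed K₁ → IsPreconnected K₂ → A₁ ⊆ K₁ →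
      B₁ ⊆ K₁ → A₂ ⊆ K₂ → B₂ ⊆ K₂ → ¬ Disjoint K₁ K₂) {n₁ n₂ k k' : ℕ} (hk : k + k' = n₁ + n₂)
    (h₁ : (f^[n₁] '' A₁ ∩ B₁).Nonempty) (h₂ : (f^[n₂] '' A₂ ∩ B₂).Nonempty) :
    (f^[k] '' A₁ ∩ B₂).Nonempty ∨ (f^[k'] '' A₂ ∩ B₁).Nonempty := by
  by_contra! hcon
  obtain ⟨hk1, hk2⟩ := hcon
  -- As much of `k` as possible is taken from `n₁`; the rest fits into `n₂` because k ≤ n₁ + n₂.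
  obtain ⟨q, p, r, s, hn₁, hn₂, hqr, hps⟩ : ∃ q p r s, p + q = n₁ ∧ r + s = n₂ ∧ r + q = k ∧
      p + s = k' :=
    ⟨min k n₁, n₁ - min k n₁, k - min k n₁, n₂ - (k - min k n₁), by omega, by omega, by omega,
      by omega⟩
  have conn : ∀ (m : ℕ) (S : Set ℂ), IsPreconnected S →
      IsPreconnected (f^[m] '' S) ∧ IsPreconnected (f^[m] ⁻¹' S) := by
    intro m S hS
    obtain ⟨g, hg⟩ := exists_homeomorph_iterate f m
    rw [← hg]
    refine ⟨hS.image _ g.continuous.continuousOn, ?_⟩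
    rw [← g.image_symm]
    exact hS.image _ g.symm.continuous.continuousOn
  have key : ∀ {A B : Set ℂ} {i j : ℕ}, IsPreconnected A → IsPreconnected B →
      (f^[i + j] '' A ∩ B).Nonempty → IsPreconnected (f^[j] '' A ∪ f^[i] ⁻¹' B) := by
    rintro A B i j hA hB ⟨_, ⟨x, hx, rfl⟩, hx'⟩
    rw [Function.iterate_add_apply] at hx'
    exact (conn j A hA).1.union _ ⟨x, hx, rfl⟩ hx' (conn i B hB).2
  have key' : ∀ {A B : Set ℂ} {i j : ℕ}, f^[i + j] '' A ∩ B = ∅ →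
      Disjoint (f^[j] '' A) (f^[i] ⁻¹' B) := by
    rintro A B i j h
    rw [disjoint_left]
    rintro _ ⟨x, hx, rfl⟩ hx'
    rw [mem_preimage, ← Function.iterate_add_apply] at hx'
    exact notMem_empty _ (h.subset ⟨⟨x, hx, rfl⟩, hx'⟩)
  have sub : ∀ {B : Set ℂ} (i : ℕ), MapsTo f B B → B ⊆ f^[i] ⁻¹' B := fun i h => h.iterate i
  subst hn₁ hn₂ hqr hps
  refine hcross (f^[q] '' A₁ ∪ f^[p] ⁻¹' B₁) (f^[s] '' A₂ ∪ f^[r] ⁻¹' B₂) (key hA₁c hB₁c h₁) ?_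
    (key hA₂c hB₂c h₂) ((subset_image_iterate hA₁ q).trans subset_union_left)
    ((sub p hB₁).trans subset_union_right) ((subset_image_iterate hA₂ s).trans subset_union_left)
    ((sub r hB₂).trans subset_union_right) ?_
  · refine IsClosed.union ?_ (hB₁cl.preimage (f.continuous.iterate p))
    obtain ⟨g, hg⟩ := exists_homeomorph_iterate f q
    rw [← hg]
    exact g.isClosedMap _ hA₁cl
  · rw [disjoint_union_left, disjoint_union_right, disjoint_union_right]
    exact ⟨⟨disjoint_image_iterate f.injective hA₁ hA₂ hA _ _, key' hk1⟩, (key' hk2).symm,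
      disjoint_preimage_iterate hB₁ hB₂ hB _ _⟩

/-! ### Transverse paths -/

namespace OrientedFoliation

variable {F : OrientedFoliation} {γ : ℝ → ℂ} {a b : ℝ}

theorem disjoint_leaf {z w : ℂ} (h : w ∉ range (F.leaf z)) :
    Disjoint (range (F.leaf w)) (range (F.leaf z)) := by
  rw [disjoint_left]
  intro x hx hx'
  rw [← F.leaf_eq z x hx', F.leaf_eq w x hx] at h
  exact h (F.mem_leaf w)

/-- The two conditions in the definition of transversality, for two parameters. -/
theorem isTransverse_iff : F.IsTransverse γ a b ↔ a ≤ b ∧ ContinuousOn γ (Icc a b) ∧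
    ∀ s ∈ Icc a b, ∀ t ∈ Icc a b, s < t →
      γ s ∈ leftSide (F.leaf (γ t)) ∧ γ t ∈ rightSide (F.leaf (γ s)) := by
  refine and_congr_right fun _ => and_congr_right fun _ => ⟨fun h s hs t ht hst => ?_, fun h t ht => ?_⟩
  · exact ⟨(h t ht).1 s ⟨hs.1, hst⟩, (h s hs).2 t ⟨hst, ht.2⟩⟩
  · exact ⟨fun u hu => (h u ⟨hu.1, hu.2.le.trans ht.2⟩ t ht hu.2).1,
      fun u hu => (h t ht u ⟨ht.1.trans hu.1.le, hu.2⟩ hu.1).2⟩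

namespace IsTransverse

/-- With `a < b` the path has a second point, and transversality then exhibits a point on the left
of the leaf, as `flatSides_leaf` requires. -/
theorem flatSides (h : F.IsTransverse γ a b) (hab : a < b) {t : ℝ} (ht : t ∈ Icc a b) :
    FlatSides (range (F.leaf (γ t))) (leftSide (F.leaf (γ t))) (rightSide (F.leaf (γ t))) := by
  refine F.flatSides_leaf ?_
  rcases ht.1.lt_or_eq with hlt | rfl
  · exact ⟨_, (h.2.2 t ht).1 a ⟨le_rfl, hlt⟩⟩
  · obtain ⟨z, hz⟩ := (h.2.2 a ht).2 b ⟨hab, le_rfl⟩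
    exact ⟨z, _, hz⟩

/-- The two leaves are disjoint, so the positions of the single points `γ s` and `γ t` determine
those of whole leaves, and then of closed half planes. -/
theorem nested (h : F.IsTransverse γ a b) {s t : ℝ} (hs : s ∈ Icc a b) (ht : t ∈ Icc a b)
    (hst : s < t) :
    leftSide (F.leaf (γ s)) ∪ range (F.leaf (γ s)) ⊆ leftSide (F.leaf (γ t)) ∧
      rightSide (F.leaf (γ t)) ∪ range (F.leaf (γ t)) ⊆ rightSide (F.leaf (γ s)) := by
  have hab : a < b := hs.1.trans_lt (hst.trans_le ht.2)
  have h1 := h.flatSides hab hs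
  have h2 := h.flatSides hab ht
  obtain ⟨hl, hr⟩ := (isTransverse_iff.1 h).2.2 s hs t ht hst
  have hd : Disjoint (range (F.leaf (γ s))) (range (F.leaf (γ t))) :=
    disjoint_leaf fun hm => disjoint_left.1 h2.symm.disjoint_right_line hl hm
  have hC : range (F.leaf (γ s)) ⊆ leftSide (F.leaf (γ t)) :=
    h2.symm.subset_right h1.isConnected.isPreconnected hd ⟨_, F.mem_leaf _, hl⟩
  have hC' : range (F.leaf (γ t)) ⊆ rightSide (F.leaf (γ s)) :=
    h1.subset_right h2.isConnected.isPreconnected hd.symm ⟨_, F.mem_leaf _, hr⟩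
  exact ⟨h2.symm.union_subset_of_subset h1 hC' hC, h1.union_subset_of_subset h2.symm hC hC'⟩

end IsTransverse

theorem IsTransverse.concatAt {γ₁ γ₂ : ℝ → ℂ} {a₁ b₁ a₂ b₂ t₁ t₂ : ℝ}
    (h₁ : F.IsTransverse γ₁ a₁ b₁) (h₂ : F.IsTransverse γ₂ a₂ b₂) (ht₁ : t₁ ∈ Icc a₁ b₁)
    (ht₂ : t₂ ∈ Icc a₂ b₂) (h : γ₁ t₁ = γ₂ t₂) :
    F.IsTransverse (concatAt γ₁ t₁ γ₂ t₂) a₁ (t₁ + (b₂ - t₂)) := by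
  have e1 : ∀ s ≤ t₁, _root_.concatAt γ₁ t₁ γ₂ t₂ s = γ₁ s := fun s hs => if_pos hs
  have e2 : ∀ s ≥ t₁, _root_.concatAt γ₁ t₁ γ₂ t₂ s = γ₂ (t₂ + (s - t₁)) := by
    intro s hs
    rcases (show t₁ ≤ s from hs).lt_or_eq with hlt | rfl
    · exact if_neg (not_le.2 hlt)
    · rw [e1 _ le_rfl, h, sub_self, add_zero]
  have m1 : ∀ s ∈ Icc a₁ (t₁ + (b₂ - t₂)), s ≤ t₁ → s ∈ Icc a₁ b₁ := fun s hs hst =>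
    ⟨hs.1, hst.trans ht₁.2⟩
  have m2 : ∀ s ∈ Icc a₁ (t₁ + (b₂ - t₂)), t₁ ≤ s → t₂ + (s - t₁) ∈ Icc a₂ b₂ := fun s hs hst =>
    ⟨by linarith [ht₂.1], by linarith [hs.2]⟩
  have hle : t₁ ≤ t₁ + (b₂ - t₂) := by linarith [ht₂.2]
  rw [isTransverse_iff] at h₁ h₂ ⊢
  refine ⟨ht₁.1.trans hle, ?_, fun s hs t ht hst => ?_⟩
  · rw [← Icc_union_Icc_eq_Icc ht₁.1 hle]
    refine ContinuousOn.union_of_isClosed ?_ ?_ isClosed_Icc isClosed_Icc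
    · exact (h₁.2.1.mono (Icc_subset_Icc_right ht₁.2)).congr fun s hs => e1 s hs.2
    · refine ContinuousOn.congr (f := fun s => γ₂ (t₂ + (s - t₁))) ?_ fun s hs => e2 s hs.1
      exact h₂.2.1.comp (by fun_prop) fun s hs => m2 s ⟨ht₁.1.trans hs.1, hs.2⟩ hs.1
  · rcases le_or_gt t t₁ with htt | htt
    · rw [e1 s (hst.le.trans htt), e1 t htt]
      exact h₁.2.2 s (m1 s hs (hst.le.trans htt)) t (m1 t ht htt) hst
    · rcases le_or_gt t₁ s with hss | hss
      · rw [e2 s hss, e2 t htt.le]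
        exact h₂.2.2 _ (m2 s hs hss) _ (m2 t ht htt.le) (by linarith)
      -- Parameters on opposite sides of the junction are compared through the common leaf.
      · rw [e1 s hss.le, e2 t htt.le]
        have n1 := (isTransverse_iff.2 h₁).nested (m1 s hs hss.le) ht₁ hss
        have n2 := (isTransverse_iff.2 h₂).nested ht₂ (m2 t ht htt.le) (by linarith)
        have k1 := h₁.2.2 s (m1 s hs hss.le) t₁ ht₁ hss
        have k2 := h₂.2.2 t₂ ht₂ _ (m2 t ht htt.le) (by linarith)
        rw [h] at k1 n1
        exact ⟨n2.1 (Or.inl k1.1), n1.2 (Or.inl k2.2)⟩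

theorem IsBrouwerFoliation.mapsTo {f : ℂ ≃ₜ ℂ} (hF : F.IsBrouwerFoliation f) {z : ℂ}
    (h : FlatSides (range (F.leaf z)) (leftSide (F.leaf z)) (rightSide (F.leaf z))) :
    MapsTo f (rightSide (F.leaf z) ∪ range (F.leaf z)) (rightSide (F.leaf z) ∪ range (F.leaf z)) := by
  intro x hx
  rw [← h.closure_right] at hx
  exact Or.inl ((hF z).2 (image_closure_subset_closure_image f.continuous ⟨x, hx, rfl⟩))

theorem IsBrouwerFoliation.subset_image {f : ℂ ≃ₜ ℂ} (hF : F.IsBrouwerFoliation f) {z : ℂ}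
    (h : FlatSides (range (F.leaf z)) (leftSide (F.leaf z)) (rightSide (F.leaf z))) :
    leftSide (F.leaf z) ∪ range (F.leaf z) ⊆ f '' (leftSide (F.leaf z) ∪ range (F.leaf z)) := by
  rw [← h.compl_right]
  intro x hx
  refine ⟨f.symm x, fun hr => hx ?_, by simp⟩
  have := (hF z).2 (subset_closure ⟨f.symm x, hr, rfl⟩)
  simpa using this

theorem _root_.IsLine.not_isBounded_range {ℓ : ℝ → ℂ} (h : IsLine ℓ) :
    ¬ Bornology.IsBounded (range ℓ) := by
  intro hb
  have hc : IsCompact (range ℓ) := Metric.isCompact_of_isClosed_isBounded h.isClosed_range hb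
  have : CompactSpace ℝ := ⟨by simpa using h.isCompact_preimage hc⟩
  exact not_compactSpace_iff.2 inferInstance this

end OrientedFoliation

/-! ### From linked half planes to admissible concatenations -/

namespace OrientedFoliation

variable {F : OrientedFoliation}

/-- The closed left side of a leaf met by a transverse path. -/
theorem IsTransverse.left_mono {γ : ℝ → ℂ} {a b s t : ℝ} (h : F.IsTransverse γ a b)
    (hs : s ∈ Icc a b) (ht : t ∈ Icc a b) (hst : s ≤ t) :
    leftSide (F.leaf (γ s)) ∪ range (F.leaf (γ s)) ⊆
      leftSide (F.leaf (γ t)) ∪ range (F.leaf (γ t)) := by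
  rcases hst.lt_or_eq with hlt | rfl
  · exact (h.nested hs ht hlt).1.trans subset_union_left
  · rfl

theorem IsTransverse.right_mono {γ : ℝ → ℂ} {a b s t : ℝ} (h : F.IsTransverse γ a b)
    (hs : s ∈ Icc a b) (ht : t ∈ Icc a b) (hst : s ≤ t) :
    rightSide (F.leaf (γ t)) ∪ range (F.leaf (γ t)) ⊆
      rightSide (F.leaf (γ s)) ∪ range (F.leaf (γ s)) := by
  rcases hst.lt_or_eq with hlt | rfl
  · exact (h.nested hs ht hlt).2.trans subset_union_left
  · rfl

/-- Two lines that do not separate each other from a third line on their right sides have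
disjoint closed left sides. -/
theorem _root_.IsAboveRel.left_subset {φ l₁ l₂ : ℝ → ℂ} (h : IsAboveRel φ l₁ l₂)
    (h₁ : FlatSides (range l₁) (leftSide l₁) (rightSide l₁))
    (h₂ : FlatSides (range l₂) (leftSide l₂) (rightSide l₂)) (hφ₁ : range φ ⊆ rightSide l₁)
    (hφ₂ : range φ ⊆ rightSide l₂) : leftSide l₂ ∪ range l₂ ⊆ rightSide l₁ := by
  obtain ⟨⟨-, -, hd⟩, ⟨-, hs₁, hs₂⟩, -⟩ := h
  refine h₁.union_subset_of_subset h₂ ?_ ?_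
  · exact (h₂.subset_or_subset h₁.isConnected.isPreconnected hd).resolve_left fun hl =>
      hs₂ (Or.inr ⟨hφ₂, hl⟩)
  · exact (h₁.subset_or_subset h₂.isConnected.isPreconnected hd.symm).resolve_left fun hl =>
      hs₁ (Or.inr ⟨hφ₁, hl⟩)

theorem _root_.IsAboveRel.right_subset {φ l₁ l₂ : ℝ → ℂ} (h : IsAboveRel φ l₁ l₂)
    (h₁ : FlatSides (range l₁) (leftSide l₁) (rightSide l₁))
    (h₂ : FlatSides (range l₂) (leftSide l₂) (rightSide l₂)) (hφ₁ : range φ ⊆ leftSide l₁)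
    (hφ₂ : range φ ⊆ leftSide l₂) : rightSide l₁ ∪ range l₁ ⊆ leftSide l₂ := by
  obtain ⟨⟨-, -, hd⟩, ⟨-, hs₁, hs₂⟩, -⟩ := h
  refine h₂.symm.union_subset_of_subset h₁.symm ?_ ?_
  · exact (h₁.subset_or_subset h₂.isConnected.isPreconnected hd.symm).resolve_right fun hl =>
      hs₁ (Or.inl ⟨hφ₁, hl⟩)
  · exact (h₂.subset_or_subset h₁.isConnected.isPreconnected hd).resolve_right fun hl =>
      hs₂ (Or.inl ⟨hφ₂, hl⟩)

/-- A concatenation of transverse paths is admissible as soon as the closed left side of its first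
leaf and the closed right side of its last leaf are linked by an iterate, provided that these are
both disjoint from a third closed left side. -/
theorem IsBrouwerFoliation.isAdmissible_concatAt {f : ℂ ≃ₜ ℂ} (hF : F.IsBrouwerFoliation f)
    {γ₁ γ₂ : ℝ → ℂ} {a₁ b₁ a₂ b₂ t₁ t₂ : ℝ} (h₁ : F.IsTransverse γ₁ a₁ b₁)
    (h₂ : F.IsTransverse γ₂ a₂ b₂) (ht₁ : t₁ ∈ Ioo a₁ b₁) (ht₂ : t₂ ∈ Ioo a₂ b₂)
    (h : γ₁ t₁ = γ₂ t₂)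
    (hd : leftSide (F.leaf (γ₂ a₂)) ∪ range (F.leaf (γ₂ a₂)) ⊆ rightSide (F.leaf (γ₁ a₁))) {n : ℕ}
    (hn : (f^[n] '' (leftSide (F.leaf (γ₁ a₁)) ∪ range (F.leaf (γ₁ a₁))) ∩
      (rightSide (F.leaf (γ₂ b₂)) ∪ range (F.leaf (γ₂ b₂)))).Nonempty) :
    F.IsAdmissible f (_root_.concatAt γ₁ t₁ γ₂ t₂) a₁ (t₁ + (b₂ - t₂)) n := by
  have hab₁ : a₁ < b₁ := ht₁.1.trans ht₁.2
  have hab₂ : a₂ < b₂ := ht₂.1.trans ht₂.2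
  have ia₁ : a₁ ∈ Icc a₁ b₁ := left_mem_Icc.2 hab₁.le
  have ia₂ : a₂ ∈ Icc a₂ b₂ := left_mem_Icc.2 hab₂.le
  have ib₂ : b₂ ∈ Icc a₂ b₂ := right_mem_Icc.2 hab₂.le
  have it₁ : t₁ ∈ Icc a₁ b₁ := Ioo_subset_Icc_self ht₁
  have it₂ : t₂ ∈ Icc a₂ b₂ := Ioo_subset_Icc_self ht₂
  refine ⟨h₁.concatAt h₂ it₁ it₂ h, ?_⟩
  have e1 : _root_.concatAt γ₁ t₁ γ₂ t₂ a₁ = γ₁ a₁ := if_pos ht₁.1.le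
  have e2 : _root_.concatAt γ₁ t₁ γ₂ t₂ (t₁ + (b₂ - t₂)) = γ₂ b₂ := by
    have : ¬ t₁ + (b₂ - t₂) ≤ t₁ := by linarith [ht₂.2]
    rw [_root_.concatAt, if_neg this]
    congr 1
    ring
  rw [e1, e2]
  have fa := h₁.flatSides hab₁ ia₁
  have fb := h₂.flatSides hab₂ ib₂
  obtain ⟨g, hg⟩ := exists_homeomorph_iterate f n
  rw [← hg] at hn ⊢
  have n₁ := h₁.nested ia₁ it₁ ht₁.1
  have n₂ := h₂.nested it₂ ib₂ ht₂.2
  rw [h] at n₁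
  -- The auxiliary set `T` is the closed left half plane at the start of `γ₂`: it is to the right of
  -- the first leaf of the concatenation and to the left of its last one.
  refine fa.image_inter_nonempty fb g ?_ (n₁.1.trans (subset_union_left.trans n₂.1)) ?_
    (n₂.2.trans (subset_union_left.trans n₁.2)) ⟨γ₂ a₂, Or.inr (F.mem_leaf _)⟩ hd
    (h₂.nested ia₂ ib₂ hab₂).1 ?_ hn
  · rw [hg]
    exact subset_image_iterate (hF.subset_image fa) n
  · rw [hg]
    exact (hF.mapsTo fb).iterate n
  · rw [hg]
    exact subset_image_iterate (hF.subset_image (h₂.flatSides hab₂ ia₂)) n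

/-- Under the assumptions of the main theorem, one of two complementary orders is attained. -/
theorem IsBrouwerFoliation.image_iterate_inter_or {f : ℂ ≃ₜ ℂ} (hF : F.IsBrouwerFoliation f)
    {γ₁ γ₂ : ℝ → ℂ} {a₁ b₁ a₂ b₂ t₁ t₂ a₁' b₁' a₂' b₂' : ℝ} {n₁ n₂ : ℕ}
    (hγ₁ : F.IsAdmissible f γ₁ a₁ b₁ n₁) (hγ₂ : F.IsAdmissible f γ₂ a₂ b₂ n₂)
    (hpoint : γ₁ t₁ = γ₂ t₂) (ha₁ : a₁' ∈ Ico a₁ t₁) (hb₁ : b₁' ∈ Ioc t₁ b₁)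
    (ha₂ : a₂' ∈ Ico a₂ t₂) (hb₂ : b₂' ∈ Ioc t₂ b₂)
    (hA : IsAboveRel (F.leaf (γ₁ t₁)) (F.leaf (γ₁ a₁')) (F.leaf (γ₂ a₂')))
    (hB : IsAboveRel (F.leaf (γ₁ t₁)) (F.leaf (γ₂ b₂')) (F.leaf (γ₁ b₁'))) :
    leftSide (F.leaf (γ₂ a₂)) ∪ range (F.leaf (γ₂ a₂)) ⊆ rightSide (F.leaf (γ₁ a₁)) ∧
    leftSide (F.leaf (γ₁ a₁)) ∪ range (F.leaf (γ₁ a₁)) ⊆ rightSide (F.leaf (γ₂ a₂)) ∧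
    ∀ k k', k + k' = n₁ + n₂ →
      (f^[k] '' (leftSide (F.leaf (γ₁ a₁)) ∪ range (F.leaf (γ₁ a₁))) ∩
        (rightSide (F.leaf (γ₂ b₂)) ∪ range (F.leaf (γ₂ b₂)))).Nonempty ∨
      (f^[k'] '' (leftSide (F.leaf (γ₂ a₂)) ∪ range (F.leaf (γ₂ a₂))) ∩
        (rightSide (F.leaf (γ₁ b₁)) ∪ range (F.leaf (γ₁ b₁)))).Nonempty := by
  obtain ⟨T₁, hn₁⟩ := hγ₁
  obtain ⟨T₂, hn₂⟩ := hγ₂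
  have lt₁ : a₁ < b₁ := ha₁.1.trans_lt (ha₁.2.trans (hb₁.1.trans_le hb₁.2))
  have lt₂ : a₂ < b₂ := ha₂.1.trans_lt (ha₂.2.trans (hb₂.1.trans_le hb₂.2))
  have ia₁ : a₁ ∈ Icc a₁ b₁ := left_mem_Icc.2 lt₁.le
  have ib₁ : b₁ ∈ Icc a₁ b₁ := right_mem_Icc.2 lt₁.le
  have ia₂ : a₂ ∈ Icc a₂ b₂ := left_mem_Icc.2 lt₂.le
  have ib₂ : b₂ ∈ Icc a₂ b₂ := right_mem_Icc.2 lt₂.le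
  have it₁ : t₁ ∈ Icc a₁ b₁ := ⟨ha₁.1.trans ha₁.2.le, hb₁.1.le.trans hb₁.2⟩
  have it₂ : t₂ ∈ Icc a₂ b₂ := ⟨ha₂.1.trans ha₂.2.le, hb₂.1.le.trans hb₂.2⟩
  have ia₁' : a₁' ∈ Icc a₁ b₁ := ⟨ha₁.1, ha₁.2.le.trans it₁.2⟩
  have ib₁' : b₁' ∈ Icc a₁ b₁ := ⟨it₁.1.trans hb₁.1.le, hb₁.2⟩
  have ia₂' : a₂' ∈ Icc a₂ b₂ := ⟨ha₂.1, ha₂.2.le.trans it₂.2⟩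
  have ib₂' : b₂' ∈ Icc a₂ b₂ := ⟨it₂.1.trans hb₂.1.le, hb₂.2⟩
  have nA₁ := T₁.nested ia₁' it₁ ha₁.2
  have nB₁ := T₁.nested it₁ ib₁' hb₁.1
  have nA₂ := T₂.nested ia₂' it₂ ha₂.2
  have nB₂ := T₂.nested it₂ ib₂' hb₂.1
  rw [← hpoint] at nA₂ nB₂
  have fa₁ := T₁.flatSides lt₁ ia₁
  have fb₁ := T₁.flatSides lt₁ ib₁
  have fa₂ := T₂.flatSides lt₂ ia₂
  have fb₂ := T₂.flatSides lt₂ ib₂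
  have fa₁' := T₁.flatSides lt₁ ia₁'
  have fb₁' := T₁.flatSides lt₁ ib₁'
  have fa₂' := T₂.flatSides lt₂ ia₂'
  have fb₂' := T₂.flatSides lt₂ ib₂'
  have fφ := T₁.flatSides lt₁ it₁
  have mA₁ := T₁.left_mono ia₁ ia₁' ha₁.1
  have mB₁ := T₁.right_mono ib₁' ib₁ hb₁.2
  have mA₂ := T₂.left_mono ia₂ ia₂' ha₂.1
  have mB₂ := T₂.right_mono ib₂' ib₂ hb₂.2
  have hll := hA.left_subset fa₁' fa₂' (subset_union_right.trans nA₁.2)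
    (subset_union_right.trans nA₂.2)
  have hmm := hB.right_subset fb₂' fb₁' (subset_union_right.trans nB₂.1)
    (subset_union_right.trans nB₁.1)
  have dA : Disjoint (leftSide (F.leaf (γ₁ a₁)) ∪ range (F.leaf (γ₁ a₁)))
      (leftSide (F.leaf (γ₂ a₂)) ∪ range (F.leaf (γ₂ a₂))) := by
    refine disjoint_left.2 fun z hz hz' => ?_
    exact (fa₁'.compl_right.symm ▸ mA₁ hz : z ∈ (rightSide _)ᶜ) (hll (mA₂ hz'))
  have dB : Disjoint (rightSide (F.leaf (γ₁ b₁)) ∪ range (F.leaf (γ₁ b₁)))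
      (rightSide (F.leaf (γ₂ b₂)) ∪ range (F.leaf (γ₂ b₂))) := by
    refine disjoint_left.2 fun z hz hz' => ?_
    exact (fb₁'.symm.compl_right.symm ▸ mB₁ hz : z ∈ (leftSide _)ᶜ) (hmm (mB₂ hz'))
  have cA : ∀ {z}, FlatSides (range (F.leaf z)) (leftSide (F.leaf z)) (rightSide (F.leaf z)) →
      IsPreconnected (leftSide (F.leaf z) ∪ range (F.leaf z)) := fun h =>
    h.symm.isPreconnected_right_union subset_rfl
  have cB : ∀ {z}, FlatSides (range (F.leaf z)) (leftSide (F.leaf z)) (rightSide (F.leaf z)) →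
      IsPreconnected (rightSide (F.leaf z) ∪ range (F.leaf z)) := fun h =>
    h.isPreconnected_right_union subset_rfl
  have ub : ∀ {z} {S : Set ℂ}, ¬ Bornology.IsBounded (S ∪ range (F.leaf z)) := fun {z S} hb =>
    IsLine.not_isBounded_range (F.isLine_leaf z) (hb.subset subset_union_right)
  have hmono : ∀ {n : ℕ} {C D S T : Set ℂ}, (f^[n] '' C ∩ D).Nonempty →
      (f^[n] '' (S ∪ C) ∩ (T ∪ D)).Nonempty := fun h =>
    h.mono (inter_subset_inter (image_mono subset_union_right) subset_union_right)
  refine ⟨?_, ?_, fun k k' hk => ?_⟩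
  · rw [← compl_compl (rightSide (F.leaf (γ₁ a₁))), fa₁.compl_right]
    exact disjoint_left.1 dA.symm
  · rw [← compl_compl (rightSide (F.leaf (γ₂ a₂))), fa₂.compl_right]
    exact disjoint_left.1 dA
  · refine _root_.image_iterate_inter_or (hF.subset_image fa₁) (hF.subset_image fa₂)
      (hF.mapsTo fb₁) (hF.mapsTo fb₂) dA dB (cA fa₁) (cA fa₂) (cB fb₁) (cB fb₂)
      fa₁.isClosed_left fb₁.symm.isClosed_left ?_ hk (hmono hn₁) (hmono hn₂)
    intro K₁ K₂ hK₁ hK₁c hK₂ hA₁ hB₁ hA₂ hB₂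
    -- The order conditions concern the inner leaves, at `a₁'`, `a₂'`, `b₁'`, `b₂'`, whereas `K₁`
    -- and `K₂` contain the smaller outer half planes; nestedness bridges the two. The rays are
    -- halves of the outer leaves of `γ₂`.
    exact not_disjoint_of_isAboveRel (F.isLine_leaf _) fφ
      (fun p hp q hq => (F.isLine_leaf _).sideIndexOne_of_mem (F.isFlat_leaf _) hp hq)
      fa₁' fa₂' fb₁' fb₂' (F.isLine_leaf _).continuous (F.isLine_leaf _).continuous
      nA₁.1 nA₂.1 nB₁.2 nB₂.2 hll hmm hA hB hK₁ hK₁c hK₂ (cA fa₁) (cB fb₁) ub ub hA₁ hB₁ mA₁ mB₁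
      (Or.inr (F.mem_leaf _)) (Or.inr (F.mem_leaf _))
      ((image_subset_range _ _).trans (subset_union_right.trans hA₂))
      ((image_subset_range _ _).trans (subset_union_right.trans hB₂))
      ((image_subset_range _ _).trans (subset_union_right.trans mA₂))
      ((image_subset_range _ _).trans (subset_union_right.trans mB₂))
      ((F.isLine_leaf (γ₂ a₂)).isRayIn 0) ((F.isLine_leaf (γ₂ b₂)).isRayIn 0)

end OrientedFoliation

theorem proposition4p3 (f : ℂ ≃ₜ ℂ) (F : OrientedFoliation) (hF : F.IsBrouwerFoliation f)
    (γ₁ γ₂ : ℝ → ℂ) (a₁ b₁ a₂ b₂ t₁ t₂ : ℝ) (n₁ n₂ : ℕ)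
    (hinter : F.IntersectTransversallyAt γ₁ a₁ b₁ γ₂ a₂ b₂ t₁ t₂)
    (hpoint : γ₁ t₁ = γ₂ t₂)
    (hγ₁ : F.IsAdmissible f γ₁ a₁ b₁ n₁) (hγ₂ : F.IsAdmissible f γ₂ a₂ b₂ n₂) :
    (F.IsAdmissible f (concatAt γ₁ t₁ γ₂ t₂) a₁ (t₁ + (b₂ - t₂)) (n₁ + n₂) ∧
      F.IsAdmissible f (concatAt γ₂ t₂ γ₁ t₁) a₂ (t₂ + (b₁ - t₁)) (n₁ + n₂)) ∧
    ((F.IsAdmissible f (concatAt γ₁ t₁ γ₂ t₂) a₁ (t₁ + (b₂ - t₂)) (max n₁ n₂) ∧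
        F.IsAdmissible f (concatAt γ₂ t₂ γ₁ t₁) a₂ (t₂ + (b₁ - t₁)) (max n₁ n₂)) ∨
      (F.IsAdmissible f (concatAt γ₁ t₁ γ₂ t₂) a₁ (t₁ + (b₂ - t₂)) (min n₁ n₂) ∨
        F.IsAdmissible f (concatAt γ₂ t₂ γ₁ t₁) a₂ (t₂ + (b₁ - t₁)) (min n₁ n₂))) := by
  obtain ⟨T₁, T₂, -, a₁', ha₁, b₁', hb₁, a₂', ha₂, b₂', hb₂, hA, hB⟩ := hinter
  have ht₁ : t₁ ∈ Ioo a₁ b₁ := ⟨ha₁.1.trans_lt ha₁.2, hb₁.1.trans_le hb₁.2⟩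
  have ht₂ : t₂ ∈ Ioo a₂ b₂ := ⟨ha₂.1.trans_lt ha₂.2, hb₂.1.trans_le hb₂.2⟩
  obtain ⟨d₁, d₂, key⟩ := hF.image_iterate_inter_or hγ₁ hγ₂ hpoint ha₁ hb₁ ha₂ hb₂ hA hB
  have adm : ∀ k k', k + k' = n₁ + n₂ →
      F.IsAdmissible f (concatAt γ₁ t₁ γ₂ t₂) a₁ (t₁ + (b₂ - t₂)) k ∨
        F.IsAdmissible f (concatAt γ₂ t₂ γ₁ t₁) a₂ (t₂ + (b₁ - t₁)) k' := fun k k' hk =>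
    (key k k' hk).imp (hF.isAdmissible_concatAt T₁ T₂ ht₁ ht₂ hpoint d₁)
      (hF.isAdmissible_concatAt T₂ T₁ ht₂ ht₁ hpoint.symm d₂)
  -- Order 0 would make the first and last leaves of a concatenation meet, but they are strictly
  -- nested.
  have zero : ∀ {γ γ' : ℝ → ℂ} {a b a' b' t t' : ℝ}, F.IsTransverse γ a b →
      F.IsTransverse γ' a' b' → t ∈ Ioo a b → t' ∈ Ioo a' b' → γ t = γ' t' →
      ¬ F.IsAdmissible f (concatAt γ t γ' t') a (t + (b' - t')) 0 := by
    rintro γ γ' a b a' b' t t' - T' ht ht' h ⟨T, hne⟩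
    have hlt : a < t + (b' - t') := by linarith [ht.1, ht'.2]
    have h1 := (T.nested (left_mem_Icc.2 hlt.le) (right_mem_Icc.2 hlt.le) hlt).1
    have h2 := T.flatSides hlt (right_mem_Icc.2 hlt.le)
    obtain ⟨x, hx, hx'⟩ := hne
    rw [Function.iterate_zero, image_id] at hx
    exact disjoint_left.1 h2.symm.disjoint_right_line (h1 (Or.inr hx)) hx'
  refine ⟨⟨(adm (n₁ + n₂) 0 rfl).resolve_right (zero T₂ T₁ ht₂ ht₁ hpoint.symm),
    (adm 0 (n₁ + n₂) (zero_add _)).resolve_left (zero T₁ T₂ ht₁ ht₂ hpoint)⟩, ?_⟩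
  -- If neither concatenation has order `min n₁ n₂`, the two complementary pairs give both of them
  -- order `max n₁ n₂`.
  rcases adm (min n₁ n₂) (max n₁ n₂) (min_add_max n₁ n₂) with h | h
  · exact Or.inr (Or.inl h)
  · rcases adm (max n₁ n₂) (min n₁ n₂) (max_add_min n₁ n₂) with h' | h'
    · exact Or.inl ⟨h', h⟩
    · exact Or.inr (Or.inr h')
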